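/- Let $K$ be a field of characteristic different from $2$ and $3$. Let $\mathbb O$ be an octonion algebra over $K$, i.e. the $8$-dimensional algebra obtained from $K$ by the Cayley–Dickson process with nonzero parameters $a,b,c\in K$ (this includes the split octonion algebra, and the algebra with the standard basis $1,e_1,\dots,e_7$ with $e_i^2=-1$, where $a=b=c=-1$), with its standard conjugation $x\mapsto\overline{x}$. Let $n\ge 1$ be an integer, let $M_n(\mathbb O)$ be the algebra of $n\times n$ matrices over $\mathbb O$, and let $J:(a_{ij})\mapsto(\overline{a_{ji}})$. Let $A$ be either the algebra of Hermitian octonionic matrices $\{x\in M_n(\mathbb O) : J(x)=x\}$ with the product $x\circ y=\frac12(xy+yx)$, or the algebra of skew-Hermitian octonionic matrices $\{x\in M_n(\mathbb O) : J(x)=-x\}$ with the product $[x,y]=xy-yx$. Let $\delta\in K$, and let $D:A\to A$ be a nonzero $\delta$-derivation of $A$, i.e. a nonzero $K$-linear map such that, with $\cdot$ denoting the product of $A$, $$D(x\cdot y)=\delta\, D(x)\cdot y+\delta\, x\cdot D(y)\qquad\text{for all } x,y\in A.$$ Then either $\delta=1$ (so $D$ is an ordinary derivation), or $\delta=\frac12$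 and $D=t\,\mathrm{id}_A$ for some $t\in K$. -/

import Mathlib

open scoped Matrix

/-- The octonion algebra over `K` with Cayley-Dickson parameters `a`, `b`, `c`: the
Cayley-Dickson double, with parameter `c`, of the quaternion algebra with `i ^ 2 = a`,
`j ^ 2 = b`, `i j = - j i`. The pair `(x, y)` is the element `x + y ℓ`, where `ℓ ^ 2 = c`. -/
@[ext]
structure Octonion {K : Type*} [Field K] (a b c : K) where
  fst : QuaternionAlgebra K a 0 b
  snd : QuaternionAlgebra K a 0 b

namespace Octonion

variable {K : Type*} [Field K] {a b c : K}

instance : Zero (Octonion a b c) := ⟨⟨0, 0⟩⟩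
instance : One (Octonion a b c) := ⟨⟨1, 0⟩⟩
instance : Add (Octonion a b c) := ⟨fun x y => ⟨x.fst + y.fst, x.snd + y.snd⟩⟩
instance : Neg (Octonion a b c) := ⟨fun x => ⟨-x.fst, -x.snd⟩⟩
instance : Sub (Octonion a b c) := ⟨fun x y => ⟨x.fst - y.fst, x.snd - y.snd⟩⟩
instance {S : Type*} [SMul S K] : SMul S (Octonion a b c) :=
  ⟨fun s x => ⟨s • x.fst, s • x.snd⟩⟩

/-- The Cayley-Dickson product `(x, y) (u, v) = (x u + c v̄ y, v x + y ū)`. -/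
instance : Mul (Octonion a b c) :=
  ⟨fun x y => ⟨x.fst * y.fst + c • (star y.snd * x.snd), y.snd * x.fst + x.snd * star y.fst⟩⟩

/-- The standard conjugation. -/
instance : Star (Octonion a b c) := ⟨fun x => ⟨star x.fst, -x.snd⟩⟩

@[simp] theorem fst_zero : (0 : Octonion a b c).fst = 0 := rfl
@[simp] theorem snd_zero : (0 : Octonion a b c).snd = 0 := rfl
@[simp] theorem fst_one : (1 : Octonion a b c).fst = 1 := rfl
@[simp] theorem snd_one : (1 : Octonion a b c).snd = 0 := rfl
@[simp] theorem fst_add (x y : Octonion a b c) : (x + y).fst = x.fst + y.fst := rfl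
@[simp] theorem snd_add (x y : Octonion a b c) : (x + y).snd = x.snd + y.snd := rfl
@[simp] theorem fst_neg (x : Octonion a b c) : (-x).fst = -x.fst := rfl
@[simp] theorem snd_neg (x : Octonion a b c) : (-x).snd = -x.snd := rfl
@[simp] theorem fst_sub (x y : Octonion a b c) : (x - y).fst = x.fst - y.fst := rfl
@[simp] theorem snd_sub (x y : Octonion a b c) : (x - y).snd = x.snd - y.snd := rfl
@[simp] theorem fst_smul {S : Type*} [SMul S K] (s : S) (x : Octonion a b c) :
    (s • x).fst = s • x.fst := rfl
@[simp] theorem snd_smul {S : Type*} [SMul S K] (s : S) (x : Octonion a b c) :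
    (s • x).snd = s • x.snd := rfl
@[simp] theorem fst_mul (x y : Octonion a b c) :
    (x * y).fst = x.fst * y.fst + c • (star y.snd * x.snd) := rfl
@[simp] theorem snd_mul (x y : Octonion a b c) :
    (x * y).snd = y.snd * x.fst + x.snd * star y.fst := rfl
@[simp] theorem fst_star (x : Octonion a b c) : (star x).fst = star x.fst := rfl
@[simp] theorem snd_star (x : Octonion a b c) : (star x).snd = -x.snd := rfl

instance : AddCommGroup (Octonion a b c) where
  add_assoc _ _ _ := by ext1 <;> simp [add_assoc]
  zero_add _ := by ext1 <;> simp
  add_zero _ := by ext1 <;> simp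
  add_comm _ _ := by ext1 <;> simp [add_comm]
  neg_add_cancel _ := by ext1 <;> simp
  sub_eq_add_neg _ _ := by ext1 <;> simp [sub_eq_add_neg]
  nsmul := (· • ·)
  nsmul_zero _ := by ext1 <;> simp
  nsmul_succ _ _ := by ext1 <;> simp [add_mul]
  zsmul := (· • ·)
  zsmul_zero' _ := by ext1 <;> simp
  zsmul_succ' _ _ := by ext1 <;> simp [add_mul]
  zsmul_neg' _ _ := by ext1 <;> simp [Int.negSucc_eq, add_mul]

instance : NonAssocRing (Octonion a b c) where
  left_distrib _ _ _ := by
    ext1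
    · simp only [fst_mul, fst_add, snd_add, star_add, mul_add, add_mul, smul_add]; abel
    · simp only [snd_mul, fst_add, snd_add, star_add, mul_add, add_mul]; abel
  right_distrib _ _ _ := by
    ext1
    · simp only [fst_mul, fst_add, snd_add, mul_add, add_mul, smul_add]; abel
    · simp only [snd_mul, fst_add, snd_add, mul_add, add_mul]; abel
  zero_mul _ := by ext1 <;> simp
  mul_zero _ := by ext1 <;> simp
  one_mul _ := by ext1 <;> simp
  mul_one _ := by ext1 <;> simp

instance : Module K (Octonion a b c) where
  one_smul _ := by ext1 <;> simp
  mul_smul _ _ _ := by ext1 <;> simp [mul_smul]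
  smul_zero _ := by ext1 <;> simp
  smul_add _ _ _ := by ext1 <;> simp
  add_smul _ _ _ := by ext1 <;> simp [add_smul]
  zero_smul _ := by ext1 <;> simp

instance : IsScalarTower K (Octonion a b c) (Octonion a b c) where
  smul_assoc s x y := by
    ext1
    · simp [smul_comm s c]
    · simp

instance : SMulCommClass K (Octonion a b c) (Octonion a b c) where
  smul_comm s x y := by
    ext1
    · simp [smul_comm s c]
    · simp

/-- Conjugation is an additive involutive antiautomorphism. -/
instance : StarRing (Octonion a b c) where
  star_involutive _ := by ext1 <;> simp
  star_add _ _ := by ext1 <;> simp [add_comm]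
  star_mul x y := by
    ext1
    · simp
    · simp only [snd_mul, snd_star, fst_star, star_star]; simp [add_comm]

theorem star_smul' (s : K) (x : Octonion a b c) : star (s • x) = s • star x := by
  ext1 <;> simp

end Octonion

/-- The product of a (not necessarily associative) algebra `A` is a bilinear map
`A →ₗ[K] A →ₗ[K] A`. A linear map `D` is a `δ`-derivation for the product `μ` if
`D (x y) = δ D(x) y + δ x D(y)` for all `x`, `y`. -/
def IsDeltaDerivation {K A : Type*} [Field K] [AddCommGroup A] [Module K A]
    (μ : A →ₗ[K] A →ₗ[K] A) (δ : K) (D : A →ₗ[K] A) : Prop :=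
  ∀ x y : A, D (μ x y) = δ • μ (D x) y + δ • μ x (D y)

section OctonionMatrices

variable {K : Type*} [Field K] (a b c : K) (n : ℕ)

theorem octonionMatrix_conjTranspose_smul (s : K)
    (X : Matrix (Fin n) (Fin n) (Octonion a b c)) : (s • X)ᴴ = s • Xᴴ := by
  ext1 i j
  simp [Matrix.conjTranspose_apply, Octonion.star_smul']

/-- The space of Hermitian `n × n` matrices over the octonions. -/
def hermitianOctonionMatrix : Submodule K (Matrix (Fin n) (Fin n) (Octonion a b c)) where
  carrier := {X | Xᴴ = X}
  add_mem' := by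
    intro X Y hX hY
    simp only [Set.mem_ofPred_eq] at *
    rw [Matrix.conjTranspose_add, hX, hY]
  zero_mem' := Matrix.conjTranspose_zero
  smul_mem' := by
    intro s X hX
    simp only [Set.mem_ofPred_eq] at *
    rw [octonionMatrix_conjTranspose_smul, hX]

/-- The space of skew-Hermitian `n × n` matrices over the octonions. -/
def skewHermitianOctonionMatrix : Submodule K (Matrix (Fin n) (Fin n) (Octonion a b c)) where
  carrier := {X | Xᴴ = -X}
  add_mem' := by
    intro X Y hX hY
    simp only [Set.mem_ofPred_eq] at *
    rw [Matrix.conjTranspose_add, hX, hY, neg_add]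
  zero_mem' := by simp
  smul_mem' := by
    intro s X hX
    simp only [Set.mem_ofPred_eq] at *
    rw [octonionMatrix_conjTranspose_smul, hX, smul_neg]

/-- The product `X ∘ Y = (X Y + Y X) / 2` of the algebra of Hermitian octonionic matrices. -/
def hermitianOctonionMatrixMul :
    hermitianOctonionMatrix a b c n →ₗ[K] hermitianOctonionMatrix a b c n →ₗ[K]
      hermitianOctonionMatrix a b c n :=
  LinearMap.mk₂ K
    (fun X Y => ⟨(2 : K)⁻¹ • (X.1 * Y.1 + Y.1 * X.1), by
      have hX : X.1ᴴ = X.1 := X.2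
      have hY : Y.1ᴴ = Y.1 := Y.2
      change ((2 : K)⁻¹ • (X.1 * Y.1 + Y.1 * X.1))ᴴ = (2 : K)⁻¹ • (X.1 * Y.1 + Y.1 * X.1)
      rw [octonionMatrix_conjTranspose_smul, Matrix.conjTranspose_add,
        Matrix.conjTranspose_mul, Matrix.conjTranspose_mul, hX, hY, add_comm]⟩)
    (fun X X' Y => Subtype.ext (by
      simp only [Submodule.coe_add, add_mul, mul_add, smul_add]; abel))
    (fun s X Y => Subtype.ext (by
      simp only [Submodule.coe_smul, Matrix.smul_mul, Matrix.mul_smul, ← smul_add]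
      rw [smul_comm]))
    (fun X Y Y' => Subtype.ext (by
      simp only [Submodule.coe_add, add_mul, mul_add, smul_add]; abel))
    (fun s X Y => Subtype.ext (by
      simp only [Submodule.coe_smul, Matrix.smul_mul, Matrix.mul_smul, ← smul_add]
      rw [smul_comm]))

/-- The product `[X, Y] = X Y - Y X` of the algebra of skew-Hermitian octonionic matrices. -/
def skewHermitianOctonionMatrixMul :
    skewHermitianOctonionMatrix a b c n →ₗ[K] skewHermitianOctonionMatrix a b c n →ₗ[K]
      skewHermitianOctonionMatrix a b c n :=
  LinearMap.mk₂ K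
    (fun X Y => ⟨X.1 * Y.1 - Y.1 * X.1, by
      have hX : X.1ᴴ = -X.1 := X.2
      have hY : Y.1ᴴ = -Y.1 := Y.2
      change (X.1 * Y.1 - Y.1 * X.1)ᴴ = -(X.1 * Y.1 - Y.1 * X.1)
      rw [Matrix.conjTranspose_sub,
        Matrix.conjTranspose_mul, Matrix.conjTranspose_mul, hX, hY, neg_mul_neg, neg_mul_neg,
        neg_sub]⟩)
    (fun X X' Y => Subtype.ext (by
      simp only [Submodule.coe_add, add_mul, mul_add]; abel))
    (fun s X Y => Subtype.ext (by
      simp only [Submodule.coe_smul, Matrix.smul_mul, Matrix.mul_smul, ← smul_sub]))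
    (fun X Y Y' => Subtype.ext (by
      simp only [Submodule.coe_add, add_mul, mul_add]; abel))
    (fun s X Y => Subtype.ext (by
      simp only [Submodule.coe_smul, Matrix.smul_mul, Matrix.mul_smul, ← smul_sub]))

end OctonionMatrices

/-! In both algebras the aim is to show that, for `δ ≠ 1`, `D` is a scalar `t` with `(2 * δ - 1) * t
= 0`. That condition makes `t • id` itself a `δ`-derivation, and `D ≠ 0` then forces `δ = 1 / 2`.

Hermitian case: the algebra is unital. If `δ ≠ 1 / 2`, then `D 1 = 2δ D 1` gives `D 1 = 0`, hence `D
X = δ D X` and `δ = 1`. If `δ = 1 / 2`, then `D` is multiplication by `z = D 1`. The diagonal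
idempotents make `z` diagonal, its entries are scalars because they are self-conjugate, and products
with off-diagonal units make them equal.

Skew-Hermitian case: the imaginary octonions under the commutator sit at each diagonal place, and
the octonions sit off the diagonal as a module over two such copies. On one copy, the compression of
`D` is a scalar (`Octonion.IsImDelta.eq_smul`). For `δ ^ 2 ≠ 1` this rests on invariance of the
trace form `re (x * y)`; for `δ = -1` it rests on the double commutator and on anti-associating
triples. Next, `exists_map_skewDiag` shows that `D` does not leave the diagonal place. Finally,
`map_skewUnit_of_ne` carries the scalar to the off-diagonal places through the left and right
actions and makes all diagonal scalars agree. -/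

namespace Octonion

/-! ### Alternativity, the trace form, and `δ`-derivations of imaginary octonions. -/

variable {K : Type*} [Field K] {a b c : K}

/-- The generators of the octonion algebra. -/
def genI : Octonion a b c := ⟨⟨0, 1, 0, 0⟩, 0⟩
def genJ : Octonion a b c := ⟨⟨0, 0, 1, 0⟩, 0⟩
def genL : Octonion a b c := ⟨0, ⟨1, 0, 0, 0⟩⟩

@[simp] theorem fst_genI : (genI : Octonion a b c).fst = ⟨0, 1, 0, 0⟩ := rfl
@[simp] theorem snd_genI : (genI : Octonion a b c).snd = 0 := rfl
@[simp] theorem fst_genJ : (genJ : Octonion a b c).fst = ⟨0, 0, 1, 0⟩ := rfl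
@[simp] theorem snd_genJ : (genJ : Octonion a b c).snd = 0 := rfl
@[simp] theorem fst_genL : (genL : Octonion a b c).fst = 0 := rfl
@[simp] theorem snd_genL : (genL : Octonion a b c).snd = ⟨1, 0, 0, 0⟩ := rfl

/-- The scalar part, as a linear form. -/
def re : Octonion a b c →ₗ[K] K where
  toFun x := x.fst.re
  map_add' _ _ := rfl
  map_smul' _ _ := rfl

theorem re_apply (x : Octonion a b c) : re x = x.fst.re := rfl

set_option maxHeartbeats 1000000 in
theorem mul_mul_self (x y : Octonion a b c) : x * (x * y) = (x * x) * y := by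
  ext <;> simp <;> ring

theorem mul_self_mul (x y : Octonion a b c) : (y * x) * x = y * (x * x) := by
  have h := congrArg star (mul_mul_self (star x) (star y))
  simpa only [star_mul, star_star] using h

theorem re_mul_comm (x y : Octonion a b c) : re (x * y) = re (y * x) := by
  simp [re_apply]; ring

/-- The product is not associative, but associators have no scalar part, so the trace form is
invariant. -/
theorem re_mul_assoc (x y z : Octonion a b c) : re ((x * y) * z) = re (x * (y * z)) := by
  simp [re_apply]; ring

theorem genI_mul_self : (genI : Octonion a b c) * genI = a • 1 := by ext <;> simp
theorem genJ_mul_self : (genJ : Octonion a b c) * genJ = b • 1 := by ext <;> simp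
theorem genL_mul_self : (genL : Octonion a b c) * genL = c • 1 := by ext <;> simp
theorem star_genI : star (genI : Octonion a b c) = -genI := by ext <;> simp
theorem star_genJ : star (genJ : Octonion a b c) = -genJ := by ext <;> simp
theorem star_genL : star (genL : Octonion a b c) = -genL := by ext <;> simp

theorem star_commutator {x y : Octonion a b c} (hx : star x = -x) (hy : star y = -y) :
    star (x * y - y * x) = -(x * y - y * x) := by
  rw [star_sub, star_mul, star_mul, hx, hy, neg_mul_neg, neg_mul_neg, neg_sub]

theorem re_eq_zero (h2 : (2 : K) ≠ 0) {x : Octonion a b c} (hx : star x = -x) : x.fst.re = 0 := by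
  have h : x.fst.re = -x.fst.re := by simpa using congrArg (fun z => z.fst.re) hx
  have : 2 * x.fst.re = 0 := by linear_combination h
  simpa [h2] using this

/-- A map on octonions which is a `δ`-derivation for commutators of imaginary octonions. -/
structure IsImDelta (δ : K) (F : Octonion a b c →ₗ[K] Octonion a b c) : Prop where
  star_map : ∀ x, star x = -x → star (F x) = -F x
  map_comm : ∀ x y, star x = -x → star y = -y →
    F (x * y - y * x) = δ • (F x * y - y * F x) + δ • (x * F y - F y * x)

theorem star_mul_of_anticomm {x y : Octonion a b c} (hx : star x = -x) (hy : star y = -y)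
    (h : y * x = -(x * y)) : star (x * y) = -(x * y) := by
  rw [star_mul, hx, hy, neg_mul_neg, h]

theorem mul_mul_of_mul_self_eq {x y : Octonion a b c} {α : K} (hxx : x * x = α • 1) :
    x * (x * y) = α • y := by
  rw [mul_mul_self, hxx, smul_mul_assoc, one_mul]

theorem mul_mul_of_anticomm_right {x y : Octonion a b c} {α : K} (hxx : x * x = α • 1)
    (h : y * x = -(x * y)) : (x * y) * x = -(α • y) := by
  rw [← neg_eq_iff_eq_neg, ← neg_mul, ← h, mul_self_mul, hxx, mul_smul_comm, mul_one]

/-- By invariance of the trace form, `[x, F y]` is orthogonal to `x`, so the unknown `F y` drops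
out. -/
theorem IsImDelta.re_mul_map {δ : K} {F : Octonion a b c →ₗ[K] Octonion a b c}
    (hF : IsImDelta δ F) {x y : Octonion a b c} (hx : star x = -x) (hy : star y = -y) :
    re (F (x * y - y * x) * x) = -δ * re (F x * (x * y - y * x)) := by
  rw [hF.map_comm x y hx hy]
  simp only [add_mul, sub_mul, mul_sub, smul_mul_assoc, map_add, map_sub, map_smul, smul_eq_mul]
  have e1 : re ((y * F x) * x) = re (F x * (x * y)) := by
    rw [re_mul_assoc, re_mul_comm, re_mul_assoc]
  have e2 : re ((x * F y) * x) = re ((F y * x) * x) := by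
    rw [re_mul_assoc, re_mul_comm]
  rw [e1, e2, re_mul_assoc (F x)]
  ring

/-- Exchanging `x` and `y` in `re (F x * y)` costs a factor `-δ`. Exchanging twice gives `δ ^ 2`, so
the value vanishes. -/
theorem IsImDelta.re_map_mul_eq_zero (h2 : (2 : K) ≠ 0) {δ : K} (hδ : δ ^ 2 ≠ 1)
    {F : Octonion a b c →ₗ[K] Octonion a b c}
    (hF : IsImDelta δ F) {x y : Octonion a b c} {α β : K} (hα : α ≠ 0) (hβ : β ≠ 0)
    (hx : star x = -x) (hy : star y = -y) (hxx : x * x = α • 1) (hyy : y * y = β • 1)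
    (h : y * x = -(x * y)) : re (F x * y) = 0 := by
  have key : ∀ {x y : Octonion a b c} {α : K}, α ≠ 0 → star x = -x → star y = -y →
      x * x = α • 1 → y * x = -(x * y) → re (F y * x) = -δ * re (F x * y) := by
    intro x y α hα hx hy hxx h
    -- With `x * y` in place of `y`, the commutator is `[x, x * y] = 2α y`.
    have h1 := hF.re_mul_map hx (star_mul_of_anticomm hx hy h)
    rw [mul_mul_of_mul_self_eq hxx, mul_mul_of_anticomm_right hxx h, sub_neg_eq_add, ← two_smul K,
      smul_smul] at h1
    simp only [map_smul, smul_mul_assoc, mul_smul_comm, smul_eq_mul] at h1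
    have : (2 * α) ≠ 0 := mul_ne_zero h2 hα
    apply mul_left_cancel₀ this
    linear_combination h1
  have h1 := key hα hx hy hxx h
  have h2 := key hβ hy hx hyy (by rw [h, neg_neg])
  have : (1 - δ ^ 2) * re (F x * y) = 0 := by
    linear_combination h2 - δ * h1
  rcases mul_eq_zero.1 this with h | h
  · exact absurd (by linear_combination -h) hδ
  · exact h

end Octonion

/-! ### Images of the generators when `δ = -1`. -/

namespace Octonion

variable {K : Type*} [Field K] {a b c : K}

/-- For anticommuting `x`, `y` one has `[x, [x, y]] = 4α y`; the derivation rule is applied to both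
brackets. -/
theorem IsImDelta.double_comm {F : Octonion a b c →ₗ[K] Octonion a b c}
    (hF : IsImDelta (-1) F) {x y : Octonion a b c} {α : K}
    (hx : star x = -x) (hy : star y = -y) (hxx : x * x = α • 1)
    (h : y * x = -(x * y)) :
    (4 * α) • F y = x * (F x * y - y * F x) - (F x * y - y * F x) * x
      + (x * (x * F y - F y * x) - (x * F y - F y * x) * x)
      - (2 : K) • (F x * (x * y) - (x * y) * F x) := by
  have hc : x * y - y * x = (2 : K) • (x * y) := by rw [h, sub_neg_eq_add, two_smul]
  have h1 := hF.map_comm x (x * y - y * x) hx (star_commutator hx hy)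
  rw [hF.map_comm x y hx hy, hc, mul_smul_comm, smul_mul_assoc, mul_mul_of_mul_self_eq hxx,
    mul_mul_of_anticomm_right hxx h] at h1
  have h3 : (2 : K) • α • y - (2 : K) • -(α • y) = (4 * α) • y := by module
  rw [h3, map_smul] at h1
  rw [h1]
  generalize F x * y - y * F x = p
  generalize x * F y - F y * x = q
  simp only [mul_add, add_mul, smul_mul_assoc, mul_smul_comm]
  generalize F x * (x * y) = r
  generalize x * y * F x = s
  module

theorem eq_smul_genI (h2 : (2 : K) ≠ 0) {f : Octonion a b c} (hf : star f = -f)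
    (h : f.fst.imJ = 0 ∧ f.fst.imK = 0 ∧ f.snd = 0) : ∃ t : K, f = t • genI := by
  obtain ⟨h3, h4, h5⟩ := h
  exact ⟨f.fst.imI, by ext <;> simp [re_eq_zero h2 hf, *]⟩

theorem eq_smul_genJ (h2 : (2 : K) ≠ 0) {f : Octonion a b c} (hf : star f = -f)
    (h : f.fst.imI = 0 ∧ f.fst.imK = 0 ∧ f.snd = 0) : ∃ t : K, f = t • genJ := by
  obtain ⟨h3, h4, h5⟩ := h
  exact ⟨f.fst.imJ, by ext <;> simp [re_eq_zero h2 hf, *]⟩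

theorem eq_smul_genL {f : Octonion a b c}
    (h : f.fst = 0 ∧ f.snd.imI = 0 ∧ f.snd.imJ = 0 ∧ f.snd.imK = 0) : ∃ t : K, f = t • genL := by
  obtain ⟨h3, h4, h5, h6⟩ := h
  exact ⟨f.snd.re, by ext <;> simp [*]⟩

theorem genJ_mul_genI : (genJ * genI : Octonion a b c) = -(genI * genJ) := by ext <;> simp
theorem genL_mul_genI : (genL * genI : Octonion a b c) = -(genI * genL) := by ext <;> simp
theorem genL_mul_genJ : (genL * genJ : Octonion a b c) = -(genJ * genL) := by ext <;> simp

theorem IsImDelta.map_genI_neg_one (h2 : (2 : K) ≠ 0) (ha : a ≠ 0) (hb : b ≠ 0) (hc : c ≠ 0)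
    {F : Octonion a b c →ₗ[K] Octonion a b c} (hF : IsImDelta (-1) F) :
    ∃ t : K, F genI = t • genI := by
  have h1 := hF.double_comm star_genI star_genJ genI_mul_self genJ_mul_genI
  have h3 := hF.double_comm star_genI star_genL genI_mul_self genL_mul_genI
  have hf := hF.star_map _ star_genI
  have r1 := re_eq_zero h2 hf
  have r2 := re_eq_zero h2 (hF.star_map _ star_genJ)
  have r3 := re_eq_zero h2 (hF.star_map _ star_genL)
  apply eq_smul_genI h2 hf
  generalize F genI = f at *
  generalize F genJ = g at *
  generalize F genL = l at *
  rw [Octonion.ext_iff, QuaternionAlgebra.ext_iff, QuaternionAlgebra.ext_iff] at h1 h3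
  rw [QuaternionAlgebra.ext_iff]
  simp [r1, r2, r3] at h1 h3 ⊢
  -- One common multiple serves all the coordinate equations. The equation with `genJ` kills the `ℓ`
  -- half of `F genI`; the one with `genL` kills the remaining quaternion coordinates.
  have cancel : ∀ u : K, 8 * a * b * c * u = 0 → u = 0 := by
    intro u hu
    have h8 : (8 : K) ≠ 0 := by
      rw [show (8 : K) = 2 ^ 3 by norm_num]
      exact pow_ne_zero 3 h2
    simpa [h8, ha, hb, hc] using hu
  obtain ⟨-, e1, e2, e3, e4⟩ := h1
  obtain ⟨-, -, -, e5, e6⟩ := h3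
  exact ⟨cancel _ (by linear_combination a * b * c * e6),
    cancel _ (by linear_combination b * c * e5),
    cancel _ (by linear_combination -a * b * c * e4),
    cancel _ (by linear_combination -b * c * e3),
    cancel _ (by linear_combination a * c * e2),
    cancel _ (by linear_combination c * e1)⟩

theorem IsImDelta.map_genJ_neg_one (h2 : (2 : K) ≠ 0) (ha : a ≠ 0) (hb : b ≠ 0) (hc : c ≠ 0)
    {F : Octonion a b c →ₗ[K] Octonion a b c} (hF : IsImDelta (-1) F) :
    ∃ t : K, F genJ = t • genJ := by
  have h1 := hF.double_comm star_genJ star_genI genJ_mul_self (by rw [genJ_mul_genI, neg_neg])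
  have h3 := hF.double_comm star_genJ star_genL genJ_mul_self genL_mul_genJ
  have hf := hF.star_map _ star_genJ
  have r1 := re_eq_zero h2 hf
  have r2 := re_eq_zero h2 (hF.star_map _ star_genI)
  have r3 := re_eq_zero h2 (hF.star_map _ star_genL)
  apply eq_smul_genJ h2 hf
  generalize F genJ = f at *
  generalize F genI = g at *
  generalize F genL = l at *
  rw [Octonion.ext_iff, QuaternionAlgebra.ext_iff, QuaternionAlgebra.ext_iff] at h1 h3
  rw [QuaternionAlgebra.ext_iff]
  simp [r1, r2, r3] at h1 h3 ⊢
  have cancel : ∀ u : K, 8 * a * b * c * u = 0 → u = 0 := by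
    intro u hu
    have h8 : (8 : K) ≠ 0 := by
      rw [show (8 : K) = 2 ^ 3 by norm_num]
      exact pow_ne_zero 3 h2
    simpa [h8, ha, hb, hc] using hu
  obtain ⟨-, e1, e2, e3, e4⟩ := h1
  obtain ⟨-, -, e5, -, e6⟩ := h3
  exact ⟨cancel _ (by linear_combination -a * b * c * e6),
    cancel _ (by linear_combination -a * c * e5),
    cancel _ (by linear_combination a * b * c * e4),
    cancel _ (by linear_combination b * c * e3),
    cancel _ (by linear_combination -a * c * e2),
    cancel _ (by linear_combination -c * e1)⟩

theorem IsImDelta.map_genL_neg_one (h2 : (2 : K) ≠ 0) (ha : a ≠ 0) (hb : b ≠ 0) (hc : c ≠ 0)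
    {F : Octonion a b c →ₗ[K] Octonion a b c} (hF : IsImDelta (-1) F) :
    ∃ t : K, F genL = t • genL := by
  have h1 := hF.double_comm star_genL star_genI genL_mul_self (by rw [genL_mul_genI, neg_neg])
  have h3 := hF.double_comm star_genL star_genJ genL_mul_self (by rw [genL_mul_genJ, neg_neg])
  have hf := hF.star_map _ star_genL
  have r1 := re_eq_zero h2 hf
  have r2 := re_eq_zero h2 (hF.star_map _ star_genI)
  have r3 := re_eq_zero h2 (hF.star_map _ star_genJ)
  apply eq_smul_genL
  generalize F genL = f at *
  generalize F genI = g at *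
  generalize F genJ = l at *
  rw [Octonion.ext_iff, QuaternionAlgebra.ext_iff, QuaternionAlgebra.ext_iff] at h1 h3
  rw [QuaternionAlgebra.ext_iff]
  simp [r1, r2, r3] at h1 h3 ⊢
  have cancel : ∀ u : K, 8 * a * b * c * u = 0 → u = 0 := by
    intro u hu
    have h8 : (8 : K) ≠ 0 := by
      rw [show (8 : K) = 2 ^ 3 by norm_num]
      exact pow_ne_zero 3 h2
    simpa [h8, ha, hb, hc] using hu
  obtain ⟨⟨-, e1, e2⟩, -, -, e3, e4⟩ := h1
  obtain ⟨⟨-, -, e5⟩, -, -, -, e6⟩ := h3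
  exact ⟨⟨cancel _ (by linear_combination a * b * c * e6),
    cancel _ (by linear_combination -a * b * c * e4),
    cancel _ (by linear_combination -b * c * e3)⟩,
    cancel _ (by linear_combination -a * b * e5),
    cancel _ (by linear_combination a * b * e2),
    cancel _ (by linear_combination b * e1)⟩
end Octonion

/-! ### Images of the generators when `δ ^ 2 ≠ 1`, and equality of the eigenvalues. -/

namespace Octonion

variable {K : Type*} [Field K] {a b c : K}

theorem IsImDelta.re_map_mul_mul_eq_zero (h2 : (2 : K) ≠ 0) {δ : K} (hδ : δ ^ 2 ≠ 1)
    {F : Octonion a b c →ₗ[K] Octonion a b c}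
    (hF : IsImDelta δ F) {x y : Octonion a b c} {α β γ : K} (hα : α ≠ 0) (hβ : β ≠ 0) (hγ : γ ≠ 0)
    (hx : star x = -x) (hy : star y = -y) (hxx : x * x = α • 1) (hyy : y * y = β • 1)
    (h : y * x = -(x * y)) (hxy : (x * y) * (x * y) = γ • 1) :
    re (F x * y) = 0 ∧ re (F x * (x * y)) = 0 := by
  refine ⟨hF.re_map_mul_eq_zero h2 hδ hα hβ hx hy hxx hyy h,
    hF.re_map_mul_eq_zero h2 hδ hα hγ hx (star_mul_of_anticomm hx hy h) hxx hxy ?_⟩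
  rw [mul_mul_of_anticomm_right hxx h, mul_mul_of_mul_self_eq hxx]

/-- `F genI` is imaginary and orthogonal to the six other imaginary basis elements, which are
reached as `y` and `genI * y` for three choices of `y`. -/
theorem IsImDelta.map_genI_of_sq_ne_one (h2 : (2 : K) ≠ 0) (ha : a ≠ 0) (hb : b ≠ 0) (hc : c ≠ 0)
    {δ : K} (hδ : δ ^ 2 ≠ 1) {F : Octonion a b c →ₗ[K] Octonion a b c} (hF : IsImDelta δ F) :
    ∃ t : K, F genI = t • genI := by
  have h3 := hF.re_map_mul_mul_eq_zero h2 hδ (x := genI) (y := genJ) (β := b) (γ := -a * b)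
    ha (by simp [hb]) (by simp [ha, hb]) star_genI (by ext <;> simp)
    genI_mul_self (by ext <;> simp) (by ext <;> simp) (by ext <;> simp)
  have h4 := hF.re_map_mul_mul_eq_zero h2 hδ (x := genI) (y := genL) (β := c) (γ := -a * c)
    ha (by simp [hc]) (by simp [ha, hc]) star_genI (by ext <;> simp)
    genI_mul_self (by ext <;> simp) (by ext <;> simp) (by ext <;> simp; ring)
  have h5 := hF.re_map_mul_mul_eq_zero h2 hδ (x := genI) (y := genJ * genL) (β := -b * c) (γ := a * b * c)
    ha (by simp [hb, hc]) (by simp [ha, hb, hc]) star_genI (by ext <;> simp)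
    genI_mul_self (by ext <;> simp; ring) (by ext <;> simp) (by ext <;> simp; ring)
  have hf := hF.star_map _ star_genI
  have hr := re_eq_zero h2 hf
  refine eq_smul_genI h2 hf ?_
  generalize F genI = f at *
  simp [re_apply, hr, ha, hb, hc] at h3 h4 h5
  simp [QuaternionAlgebra.ext_iff, *]

theorem IsImDelta.map_genJ_of_sq_ne_one (h2 : (2 : K) ≠ 0) (ha : a ≠ 0) (hb : b ≠ 0) (hc : c ≠ 0)
    {δ : K} (hδ : δ ^ 2 ≠ 1) {F : Octonion a b c →ₗ[K] Octonion a b c} (hF : IsImDelta δ F) :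
    ∃ t : K, F genJ = t • genJ := by
  have h3 := hF.re_map_mul_mul_eq_zero h2 hδ (x := genJ) (y := genI) (β := a) (γ := -a * b)
    hb (by simp [ha]) (by simp [ha, hb]) star_genJ (by ext <;> simp)
    genJ_mul_self (by ext <;> simp) (by ext <;> simp) (by ext <;> simp)
  have h4 := hF.re_map_mul_mul_eq_zero h2 hδ (x := genJ) (y := genL) (β := c) (γ := -b * c)
    hb (by simp [hc]) (by simp [hb, hc]) star_genJ (by ext <;> simp)
    genJ_mul_self (by ext <;> simp) (by ext <;> simp) (by ext <;> simp; ring)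
  have h5 := hF.re_map_mul_mul_eq_zero h2 hδ (x := genJ) (y := genI * genL) (β := -a * c) (γ := a * b * c)
    hb (by simp [ha, hc]) (by simp [ha, hb, hc]) star_genJ (by ext <;> simp)
    genJ_mul_self (by ext <;> simp; ring) (by ext <;> simp) (by ext <;> simp; ring)
  have hf := hF.star_map _ star_genJ
  have hr := re_eq_zero h2 hf
  refine eq_smul_genJ h2 hf ?_
  generalize F genJ = f at *
  simp [re_apply, hr, ha, hb, hc] at h3 h4 h5
  simp [QuaternionAlgebra.ext_iff, *]

theorem IsImDelta.map_genL_of_sq_ne_one (h2 : (2 : K) ≠ 0) (ha : a ≠ 0) (hb : b ≠ 0) (hc : c ≠ 0)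
    {δ : K} (hδ : δ ^ 2 ≠ 1) {F : Octonion a b c →ₗ[K] Octonion a b c} (hF : IsImDelta δ F) :
    ∃ t : K, F genL = t • genL := by
  have h3 := hF.re_map_mul_mul_eq_zero h2 hδ (x := genL) (y := genI) (β := a) (γ := -a * c)
    hc (by simp [ha]) (by simp [ha, hc]) star_genL (by ext <;> simp)
    genL_mul_self (by ext <;> simp) (by ext <;> simp) (by ext <;> simp; ring)
  have h4 := hF.re_map_mul_mul_eq_zero h2 hδ (x := genL) (y := genJ) (β := b) (γ := -b * c)
    hc (by simp [hb]) (by simp [hb, hc]) star_genL (by ext <;> simp)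
    genL_mul_self (by ext <;> simp) (by ext <;> simp) (by ext <;> simp; ring)
  have h5 := hF.re_map_mul_mul_eq_zero h2 hδ (x := genL) (y := genI * genJ) (β := -a * b) (γ := a * b * c)
    hc (by simp [ha, hb]) (by simp [ha, hb, hc]) star_genL (by ext <;> simp)
    genL_mul_self (by ext <;> simp) (by ext <;> simp) (by ext <;> simp; ring)
  have hf := hF.star_map _ star_genL
  have hr := re_eq_zero h2 hf
  refine eq_smul_genL ?_
  generalize F genL = f at *
  simp [re_apply, hr, ha, hb, hc] at h3 h4 h5
  simp [QuaternionAlgebra.ext_iff, *]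

theorem IsImDelta.map_generators (h2 : (2 : K) ≠ 0) (ha : a ≠ 0) (hb : b ≠ 0) (hc : c ≠ 0)
    {δ : K} (hδ : δ ≠ 1) {F : Octonion a b c →ₗ[K] Octonion a b c} (hF : IsImDelta δ F) :
    (∃ t : K, F genI = t • genI) ∧ (∃ t : K, F genJ = t • genJ) ∧ ∃ t : K, F genL = t • genL := by
  by_cases h : δ ^ 2 = 1
  · obtain rfl : δ = -1 := (mul_self_eq_one_iff.1 (by rw [← sq, h])).resolve_left hδ
    exact ⟨hF.map_genI_neg_one h2 ha hb hc, hF.map_genJ_neg_one h2 ha hb hc,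
      hF.map_genL_neg_one h2 ha hb hc⟩
  · exact ⟨hF.map_genI_of_sq_ne_one h2 ha hb hc h, hF.map_genJ_of_sq_ne_one h2 ha hb hc h,
      hF.map_genL_of_sq_ne_one h2 ha hb hc h⟩

theorem IsImDelta.map_mul (h2 : (2 : K) ≠ 0) {δ : K} {F : Octonion a b c →ₗ[K] Octonion a b c}
    (hF : IsImDelta δ F) {x y : Octonion a b c} {s t : K} (hx : star x = -x) (hy : star y = -y)
    (h : y * x = -(x * y)) (hs : F x = s • x) (ht : F y = t • y) :
    F (x * y) = (δ * (s + t)) • (x * y) := by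
  have h1 := hF.map_comm x y hx hy
  rw [hs, ht] at h1
  simp only [smul_mul_assoc, mul_smul_comm, h, sub_neg_eq_add, ← two_smul K (x * y),
    map_smul] at h1
  apply smul_right_injective _ h2
  simp only
  rw [h1]
  module

/-- Since `y * (x * y) = -β x`, the eigenvalue of `x` can be recomputed by two applications of
`map_mul`. -/
theorem IsImDelta.eigenvalue_eq (h2 : (2 : K) ≠ 0) {δ : K} {F : Octonion a b c →ₗ[K] Octonion a b c}
    (hF : IsImDelta δ F) {x y : Octonion a b c} {s t β : K} (hx : star x = -x) (hy : star y = -y)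
    (hx0 : x ≠ 0) (hβ : β ≠ 0) (hyy : y * y = β • 1)
    (h : y * x = -(x * y)) (hs : F x = s • x) (ht : F y = t • y) :
    s = δ * (t + δ * (s + t)) := by
  have hz : y * (x * y) = -(β • x) := by
    rw [← neg_eq_iff_eq_neg, ← mul_neg, ← h, mul_mul_of_mul_self_eq hyy]
  have h1 := hF.map_mul h2 hy (star_mul_of_anticomm hx hy h) (s := t) (t := δ * (s + t))
    (by rw [hz, neg_neg, mul_self_mul, hyy, mul_smul_comm, mul_one]) ht
    (hF.map_mul h2 hx hy h hs ht)
  rw [hz, map_neg, map_smul, hs, smul_neg, neg_inj, smul_comm] at h1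
  exact smul_left_injective K (smul_ne_zero hβ hx0) (by simpa [smul_smul, mul_comm] using h1)

/-- The two bracketings of `x y z` are proportional, so their eigenvalues `r + s - t` and `-r + s +
t` agree. This covers `δ = -1`, where `eigenvalue_eq` is vacuous on exchange of `x` and `y`. -/
theorem IsImDelta.eigenvalue_eq_of_antiassoc (h2 : (2 : K) ≠ 0)
    {F : Octonion a b c →ₗ[K] Octonion a b c}
    (hF : IsImDelta (-1) F) {x y z : Octonion a b c} {r s t : K} (hx : star x = -x)
    (hy : star y = -y) (hz : star z = -z) (hxy : y * x = -(x * y)) (hyz : z * y = -(y * z))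
    (hxyz : z * (x * y) = -((x * y) * z)) (hyzx : (y * z) * x = -(x * (y * z)))
    (hassoc : x * (y * z) = -((x * y) * z)) (h0 : (x * y) * z ≠ 0)
    (hr : F x = r • x) (hs : F y = s • y) (ht : F z = t • z) : r = t := by
  have h1 := hF.map_mul h2 (star_mul_of_anticomm hx hy hxy) hz hxyz
    (hF.map_mul h2 hx hy hxy hr hs) ht
  have h3 := hF.map_mul h2 hx (star_mul_of_anticomm hy hz hyz) hyzx hr
    (hF.map_mul h2 hy hz hyz hs ht)
  rw [hassoc, map_neg, h1, smul_neg, neg_inj] at h3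
  have h4 := smul_left_injective K h0 h3
  exact mul_left_cancel₀ h2 (by linear_combination h4)

theorem eq_of_star_eq_neg (h2 : (2 : K) ≠ 0) {x : Octonion a b c} (hx : star x = -x) :
    x = x.fst.imI • genI + x.fst.imJ • genJ + x.fst.imK • (genI * genJ) + x.snd.re • genL
      + x.snd.imI • (genI * genL) + x.snd.imJ • (genJ * genL)
      + x.snd.imK • ((genI * genJ) * genL) := by
  ext <;> simp [re_eq_zero h2 hx]

theorem genI_ne_zero : (genI : Octonion a b c) ≠ 0 := fun h => by
  have h1 : (genI : Octonion a b c).fst.imI = 0 := by rw [h]; rfl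
  simp at h1

theorem genJ_ne_zero : (genJ : Octonion a b c) ≠ 0 := fun h => by
  have h1 : (genJ : Octonion a b c).fst.imJ = 0 := by rw [h]; rfl
  simp at h1

theorem genL_ne_zero : (genL : Octonion a b c) ≠ 0 := fun h => by
  have h1 : (genL : Octonion a b c).snd.re = 0 := by rw [h]; rfl
  simp at h1

theorem star_genI_mul_genJ : star (genI * genJ : Octonion a b c) = -(genI * genJ) :=
  star_mul_of_anticomm star_genI star_genJ genJ_mul_genI

theorem IsImDelta.eigenvalue_eq_neg_one (h2 : (2 : K) ≠ 0) (hb : b ≠ 0)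
    {F : Octonion a b c →ₗ[K] Octonion a b c} (hF : IsImDelta (-1) F) {r s t : K}
    (hr : F genI = r • genI) (hs : F genJ = s • genJ) (ht : F genL = t • genL) :
    r = t ∧ s = t ∧ -1 * (r + s) = t := by
  have hK := hF.map_mul h2 star_genI star_genJ genJ_mul_genI hr hs
  refine ⟨hF.eigenvalue_eq_of_antiassoc h2 star_genI star_genJ star_genL
      genJ_mul_genI genL_mul_genJ (by ext <;> simp) (by ext <;> simp) (by ext <;> simp) ?_ hr hs ht,
    hF.eigenvalue_eq_of_antiassoc h2 star_genJ star_genI star_genL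
      (by rw [genJ_mul_genI, neg_neg]) genL_mul_genI (by ext <;> simp) (by ext <;> simp)
      (by ext <;> simp) ?_ hs hr ht,
    hF.eigenvalue_eq_of_antiassoc h2 star_genI_mul_genJ star_genJ star_genL
      (by ext <;> simp) genL_mul_genJ (by ext <;> simp) (by ext <;> simp)
      (by ext <;> simp) ?_ hK hs ht⟩
  · intro h
    have h1 : (genI * genJ * genL : Octonion a b c).snd.imK = 0 := by rw [h]; rfl
    simp at h1
  · intro h
    have h1 : (genJ * genI * genL : Octonion a b c).snd.imK = 0 := by rw [h]; rfl
    simp at h1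
  · intro h
    have h1 : (genI * genJ * genJ * genL : Octonion a b c).snd.imI = 0 := by rw [h]; rfl
    simp [hb] at h1

theorem IsImDelta.exists_eigenvalue (h2 : (2 : K) ≠ 0) (ha : a ≠ 0) (hb : b ≠ 0)
    (hc : c ≠ 0) {δ : K} (hδ : δ ≠ 1) {F : Octonion a b c →ₗ[K] Octonion a b c}
    (hF : IsImDelta δ F) :
    ∃ t : K, (2 * δ - 1) * t = 0 ∧ F genI = t • genI ∧ F genJ = t • genJ ∧ F genL = t • genL := by
  obtain ⟨⟨r, hr⟩, ⟨s, hs⟩, t, ht⟩ := hF.map_generators h2 ha hb hc hδ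
  suffices r = s ∧ r = t ∧ (2 * δ - 1) * t = 0 by
    obtain ⟨rfl, rfl, h⟩ := this
    exact ⟨r, h, hr, hs, ht⟩
  by_cases h : δ = -1
  · subst h
    obtain ⟨e1, e2, e3⟩ := hF.eigenvalue_eq_neg_one h2 hb hr hs ht
    exact ⟨by rw [e1, e2], e1, by linear_combination e3 + e1 + e2⟩
  · have h1 : δ + 1 ≠ 0 := fun h' => h (by linear_combination h')
    have e1 := hF.eigenvalue_eq h2 star_genI star_genJ genI_ne_zero hb genJ_mul_self
      genJ_mul_genI hr hs
    have e2 := hF.eigenvalue_eq h2 star_genJ star_genI genJ_ne_zero ha genI_mul_self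
      (by rw [genJ_mul_genI, neg_neg]) hs hr
    have e3 := hF.eigenvalue_eq h2 star_genI star_genL genI_ne_zero hc genL_mul_self
      genL_mul_genI hr ht
    have e4 := hF.eigenvalue_eq h2 star_genL star_genI genL_ne_zero ha genI_mul_self
      (by rw [genL_mul_genI, neg_neg]) ht hr
    -- The difference of the two exchanged relations is `(δ + 1) * (r - s) = 0`.
    have e5 : r = s := mul_left_cancel₀ h1 (by linear_combination e1 - e2)
    have e6 : r = t := mul_left_cancel₀ h1 (by linear_combination e3 - e4)
    -- With equal eigenvalues the relation becomes `(2δ² + δ - 1) r = 0`, and the quadratic is `(δ +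
    -- 1)(2δ - 1)`.
    refine ⟨e5, e6, mul_left_cancel₀ h1 ?_⟩
    subst e6
    linear_combination -e3

theorem IsImDelta.eq_smul (h2 : (2 : K) ≠ 0) (ha : a ≠ 0) (hb : b ≠ 0)
    (hc : c ≠ 0) {δ : K} (hδ : δ ≠ 1) {F : Octonion a b c →ₗ[K] Octonion a b c}
    (hF : IsImDelta δ F) :
    ∃ t : K, (2 * δ - 1) * t = 0 ∧ ∀ x, star x = -x → F x = t • x := by
  obtain ⟨r, hδr, hr, hs, ht⟩ := hF.exists_eigenvalue h2 ha hb hc hδ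
  refine ⟨r, hδr, fun x hx => ?_⟩
  -- Hence a product of anticommuting imaginary `r`-eigenvectors is again an `r`-eigenvector, and
  -- the generators yield the whole basis.
  have hd : δ * (r + r) = r := by linear_combination hδr
  have m1 := hF.map_mul h2 star_genI star_genJ genJ_mul_genI hr hs
  have m2 := hF.map_mul h2 star_genI star_genL genL_mul_genI hr ht
  have m3 := hF.map_mul h2 star_genJ star_genL genL_mul_genJ hs ht
  rw [hd] at m1 m2 m3
  have m4 := hF.map_mul h2 star_genI_mul_genJ star_genL (by ext <;> simp) m1 ht
  rw [hd] at m4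
  rw [eq_of_star_eq_neg h2 hx]
  simp only [map_add, map_smul, hr, hs, ht, m1, m2, m3, m4, smul_add, smul_comm r]

end Octonion

/-! ### Elementary skew-Hermitian matrices and their products. -/

section SkewHermitian

variable {K : Type*} [Field K] {a b c : K} {n : ℕ}

/-- The skew-Hermitian matrix with entry `p` in place `(i, j)` and `-star p` in place `(j, i)`
(these are added if `i = j`). -/
def skewUnit (i j : Fin n) : Octonion a b c →ₗ[K] skewHermitianOctonionMatrix a b c n where
  toFun p := ⟨Matrix.single i j p - Matrix.single j i (star p), by
    change (_ : Matrix _ _ _)ᴴ = -_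
    rw [Matrix.conjTranspose_sub, Matrix.conjTranspose_single, Matrix.conjTranspose_single,
      star_star, neg_sub]⟩
  map_add' p q := Subtype.ext (by
    simp only [Submodule.coe_add, star_add, Matrix.single_add]; abel)
  map_smul' s p := Subtype.ext (by
    simp only [Submodule.coe_smul, Octonion.star_smul', RingHom.id_apply, smul_sub,
      Matrix.smul_single])

theorem coe_skewUnit (i j : Fin n) (p : Octonion a b c) :
    (skewUnit i j p).1 = Matrix.single i j p - Matrix.single j i (star p) := rfl

theorem skewUnit_swap (i j : Fin n) (p : Octonion a b c) :
    skewUnit j i (star p) = -skewUnit i j p :=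
  Subtype.ext (by simp [coe_skewUnit])

/-- The diagonal matrix whose only nonzero entry is the imaginary part of `x`. -/
def skewDiag (i : Fin n) : Octonion a b c →ₗ[K] skewHermitianOctonionMatrix a b c n :=
  (2 : K)⁻¹ • skewUnit i i

theorem coe_skewDiag (h2 : (2 : K) ≠ 0) (i : Fin n) {x : Octonion a b c} (hx : star x = -x) :
    (skewDiag i x).1 = Matrix.single i i x := by
  simp only [skewDiag, LinearMap.smul_apply, Submodule.coe_smul, coe_skewUnit, hx,
    ← Matrix.single_neg, sub_neg_eq_add]
  rw [← two_smul K, inv_smul_smul₀ h2]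

/-- An entry of a skew-Hermitian matrix, as a linear map. -/
def skewEntry (i j : Fin n) : skewHermitianOctonionMatrix a b c n →ₗ[K] Octonion a b c where
  toFun X := X.1 i j
  map_add' _ _ := rfl
  map_smul' _ _ := rfl

theorem skewEntry_apply (i j : Fin n) (X : skewHermitianOctonionMatrix a b c n) :
    skewEntry i j X = X.1 i j := rfl

theorem skew_ext {X Y : skewHermitianOctonionMatrix a b c n}
    (h : ∀ i j, skewEntry i j X = skewEntry i j Y) : X = Y :=
  Subtype.ext (Matrix.ext h)

theorem skewEntry_swap (i j : Fin n) (X : skewHermitianOctonionMatrix a b c n) :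
    skewEntry j i X = -star (skewEntry i j X) := by
  have h : X.1ᴴ = -X.1 := X.2
  have h1 := congrFun (congrFun h j) i
  rw [Matrix.conjTranspose_apply, Matrix.neg_apply] at h1
  rw [skewEntry_apply, skewEntry_apply, h1, neg_neg]

theorem coe_skewMul (X Y : skewHermitianOctonionMatrix a b c n) :
    (skewHermitianOctonionMatrixMul a b c n X Y).1 = X.1 * Y.1 - Y.1 * X.1 := rfl

theorem skewMul_swap (X Y : skewHermitianOctonionMatrix a b c n) :
    skewHermitianOctonionMatrixMul a b c n Y X = -skewHermitianOctonionMatrixMul a b c n X Y :=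
  Subtype.ext (by rw [Submodule.coe_neg, coe_skewMul, coe_skewMul, neg_sub])

theorem skewEntry_skewDiag_mul (h2 : (2 : K) ≠ 0) (i k l : Fin n) {x : Octonion a b c}
    (hx : star x = -x) (Y : skewHermitianOctonionMatrix a b c n) :
    skewEntry k l (skewHermitianOctonionMatrixMul a b c n (skewDiag i x) Y) =
      (if k = i then x * skewEntry i l Y else 0) - (if l = i then skewEntry k i Y * x else 0) := by
  rw [skewEntry_apply, coe_skewMul, coe_skewDiag h2 i hx, Matrix.sub_apply]
  congr 1
  · split_ifs with h
    · subst h; simp [skewEntry_apply]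
    · simp [h]
  · split_ifs with h
    · subst h; simp [skewEntry_apply]
    · simp [h]

theorem skewDiag_mul_skewDiag (h2 : (2 : K) ≠ 0) (i : Fin n) {x y : Octonion a b c}
    (hx : star x = -x) (hy : star y = -y) :
    skewHermitianOctonionMatrixMul a b c n (skewDiag i x) (skewDiag i y) =
      skewDiag i (x * y - y * x) := by
  apply Subtype.ext
  rw [coe_skewMul, coe_skewDiag h2 i hx, coe_skewDiag h2 i hy,
    coe_skewDiag h2 i (Octonion.star_commutator hx hy), Matrix.single_mul_single_same,
    Matrix.single_mul_single_same, sub_eq_add_neg, Matrix.single_neg, ← Matrix.single_add,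
    ← sub_eq_add_neg]

theorem skewDiag_mul_skewDiag_of_ne (h2 : (2 : K) ≠ 0) {i j : Fin n} (hij : i ≠ j)
    {x y : Octonion a b c} (hx : star x = -x) (hy : star y = -y) :
    skewHermitianOctonionMatrixMul a b c n (skewDiag i x) (skewDiag j y) = 0 := by
  apply Subtype.ext
  rw [coe_skewMul, coe_skewDiag h2 i hx, coe_skewDiag h2 j hy,
    Matrix.single_mul_single_of_ne _ _ _ _ hij, Matrix.single_mul_single_of_ne _ _ _ _ hij.symm,
    sub_zero, Submodule.coe_zero]

theorem skewDiag_mul_skewUnit (h2 : (2 : K) ≠ 0) {i j : Fin n} (hij : i ≠ j)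
    {x : Octonion a b c} (hx : star x = -x) (p : Octonion a b c) :
    skewHermitianOctonionMatrixMul a b c n (skewDiag i x) (skewUnit i j p) =
      skewUnit i j (x * p) := by
  apply Subtype.ext
  rw [coe_skewMul, coe_skewDiag h2 i hx, coe_skewUnit, coe_skewUnit, mul_sub, sub_mul,
    Matrix.single_mul_single_same, Matrix.single_mul_single_same,
    Matrix.single_mul_single_of_ne _ _ _ _ hij, Matrix.single_mul_single_of_ne _ _ _ _ hij.symm,
    star_mul, hx, mul_neg, ← Matrix.single_neg]
  abel

/-- The factor `2⁻¹` appears because the double sum equals `X - Xᴴ = 2X`. -/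
theorem eq_sum_skewUnit (h2 : (2 : K) ≠ 0) (X : skewHermitianOctonionMatrix a b c n) :
    X = (2 : K)⁻¹ • ∑ i, ∑ j, skewUnit i j (skewEntry i j X) := by
  rw [eq_inv_smul_iff₀ h2]
  apply Subtype.ext
  have h : X.1ᴴ = -X.1 := X.2
  have h1 : ∑ i, ∑ j, Matrix.single j i (star (X.1 i j)) = -X.1 := by
    rw [Finset.sum_comm, ← h]
    exact (Matrix.matrix_eq_sum_single X.1ᴴ).symm
  simp only [Submodule.coe_smul, Submodule.coe_sum, coe_skewUnit, Finset.sum_sub_distrib,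
    skewEntry_apply, h1, ← Matrix.matrix_eq_sum_single]
  rw [two_smul, sub_neg_eq_add]

end SkewHermitian

/-! ### Octonion identities that control the entries outside a diagonal place. -/

namespace Octonion

variable {K : Type*} [Field K] {a b c : K}

/-- The double commutator with `genI` multiplies `z` by `4a` but loses its `genI` coordinate, which
`[genJ, [genJ, genI]]` restores. Hence commutators span the imaginary octonions. -/
theorem four_mul_smul_eq_commutators (h2 : (2 : K) ≠ 0) {z : Octonion a b c} (hz : star z = -z) :
    (4 * a * b) • z = b • (genI * (genI * z - z * genI) - (genI * z - z * genI) * genI)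
      + (a * z.fst.imI) • (genJ * (genJ * genI - genI * genJ)
        - (genJ * genI - genI * genJ) * genJ) := by
  have hr := re_eq_zero h2 hz
  ext <;> simp [hr] <;> ring

theorem map_eq_zero_of_map_commutator {V : Type*} [AddCommGroup V] [Module K V] (h2 : (2 : K) ≠ 0)
    (ha : a ≠ 0) (hb : b ≠ 0) (φ : Octonion a b c →ₗ[K] V)
    (h : ∀ x y, star x = -x → star y = -y → φ (x * y - y * x) = 0)
    {z : Octonion a b c} (hz : star z = -z) : φ z = 0 := by
  have h4 : 4 * a * b ≠ 0 := by
    rw [show (4 : K) = 2 * 2 by norm_num]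
    exact mul_ne_zero (mul_ne_zero (mul_ne_zero h2 h2) ha) hb
  have h1 := congrArg φ (four_mul_smul_eq_commutators h2 hz)
  rw [map_add, map_smul, map_smul, map_smul, h _ _ star_genI (star_commutator star_genI hz),
    h _ _ star_genJ (star_commutator star_genJ star_genI), smul_zero, smul_zero, add_zero] at h1
  exact (smul_eq_zero.1 h1).resolve_left h4

/-- Compared by coordinates, the quaternion half of `q` acquires the factor `2ab(1 - δ)`, which is
where `δ ≠ 1` enters; the `ℓ` half vanishes without it. -/
theorem eq_zero_of_commutator_relation (h2 : (2 : K) ≠ 0) (ha : a ≠ 0) (hb : b ≠ 0)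
    {δ : K} (hδ : δ ≠ 1) (q : Octonion a b c)
    (h : ((genI * genJ - genJ * genI) * q) * genI =
      δ • (genI * ((genJ * q) * genI) - genJ * ((genI * q) * genI))) : q = 0 := by
  have hd : 1 - δ ≠ 0 := sub_ne_zero.2 hδ.symm
  have hc1 : ∀ u : K, 2 * a * b * (1 - δ) * u = 0 → u = 0 := by
    intro u hu
    simpa [h2, ha, hb, hd] using hu
  have hc2 : ∀ u : K, 2 * a * b * u = 0 → u = 0 := by
    intro u hu
    simpa [h2, ha, hb] using hu
  rw [Octonion.ext_iff, QuaternionAlgebra.ext_iff, QuaternionAlgebra.ext_iff] at h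
  have h11 : (1 + 1 : K) ≠ 0 := by rwa [one_add_one_eq_two]
  simp [ha, h11] at h
  obtain ⟨⟨e0, e1, e2, e3⟩, e4, e5, e6, e7⟩ := h
  ext
  · exact hc1 _ (by linear_combination -b * e2)
  · exact hc1 _ (by linear_combination b * e3)
  · exact hc1 _ (by linear_combination e0)
  · exact hc1 _ (by linear_combination -e1)
  · exact e6
  · exact e7
  · exact hc2 _ (by linear_combination e4)
  · exact hc2 _ (by linear_combination e5)

theorem eq_zero_of_mul_genI_eq_zero (ha : a ≠ 0) {x : Octonion a b c} (h : x * genI = 0) :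
    x = 0 := by
  have h1 := mul_self_mul genI x
  rw [h, zero_mul, genI_mul_self, mul_smul_comm, mul_one] at h1
  exact (smul_eq_zero.1 h1.symm).resolve_left ha

/-- Taking `y = genI` in `h` expresses `φ` through the single octonion `ψ genI`; the relation `hφ`
on `genI`, `genJ` then forces that octonion to vanish. -/
theorem map_eq_zero_of_intertwining (h2 : (2 : K) ≠ 0) (ha : a ≠ 0) (hb : b ≠ 0)
    {δ : K} (hδ : δ ≠ 1) (φ ψ : Octonion a b c →ₗ[K] Octonion a b c)
    (h : ∀ x y, star x = -x → star y = -y → φ x * y + x * ψ y = 0)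
    (hφ : ∀ x y, star x = -x → star y = -y → φ (x * y - y * x) = δ • (x * φ y - y * φ x))
    {z : Octonion a b c} (hz : star z = -z) : φ z = 0 := by
  have key : ∀ x : Octonion a b c, star x = -x → a • φ x = -((x * ψ genI) * genI) := by
    intro x hx
    have h1 := congrArg (· * genI) (h x genI hx star_genI)
    simp only [add_mul, mul_self_mul, genI_mul_self, mul_smul_comm, mul_one, zero_mul] at h1
    exact eq_neg_of_add_eq_zero_left h1
  have hq : ψ genI = 0 := by
    apply eq_zero_of_commutator_relation h2 ha hb hδ
    have h1 := congrArg (a • ·) (hφ _ _ star_genI star_genJ)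
    simp only [key _ (star_commutator star_genI star_genJ)] at h1
    rw [smul_comm, smul_sub, ← mul_smul_comm, ← mul_smul_comm, key _ star_genI, key _ star_genJ,
      mul_neg, mul_neg, neg_sub_neg, ← neg_sub (genI * _), smul_neg, neg_inj] at h1
    exact h1
  apply eq_zero_of_mul_genI_eq_zero ha
  simpa [hq] using h z genI hz star_genI

/-- The case `δ = -1` of the equations satisfied by the off-diagonal components. -/
theorem map_eq_zero_of_anti_module (h2 : (2 : K) ≠ 0) (ha : a ≠ 0) (hb : b ≠ 0)
    (g : Octonion a b c →ₗ[K] Octonion a b c)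
    (hl : ∀ x p, star x = -x → g (x * p) = -(x * g p))
    (hr : ∀ x p, star x = -x → g (p * x) = -(g p * x)) (p : Octonion a b c) : g p = 0 := by
  -- Evaluating `g genI` in two ways shows that `g 1` commutes with `genI`, which leaves only the
  -- span of `1` and `genI`. Evaluating `g (genI * genJ)` in two ways removes that span.
  have h1 : g 1 = 0 := by
    have e1 := hl genI 1 star_genI
    have e2 := hr genI 1 star_genI
    have e3 := hl genI genJ star_genI
    have e4 := hl genJ 1 star_genJ
    have e5 := hl (genI * genJ) 1 star_genI_mul_genJ
    rw [mul_one] at e1 e4 e5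
    rw [one_mul, e1, neg_inj] at e2
    rw [e4, e5, mul_neg, neg_neg] at e3
    generalize g 1 = s at *
    have hc2 : ∀ u : K, 2 * a * b * u = 0 → u = 0 := by
      intro u hu
      simpa [h2, ha, hb] using hu
    rw [Octonion.ext_iff, QuaternionAlgebra.ext_iff, QuaternionAlgebra.ext_iff] at e2 e3
    simp at e2 e3
    obtain ⟨⟨f0, f1⟩, f2, f3, f4, f5⟩ := e2
    obtain ⟨⟨-, -, f6, f7⟩, -⟩ := e3
    ext
    · exact hc2 _ (by linear_combination -a * b * f7)
    · exact hc2 _ (by linear_combination b * f6)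
    · exact hc2 _ (by linear_combination a * b * f1)
    · exact hc2 _ (by linear_combination b * f0)
    · exact hc2 _ (by linear_combination a * b * f3)
    · exact hc2 _ (by linear_combination b * f2)
    · exact hc2 _ (by linear_combination -a * b * f5)
    · exact hc2 _ (by linear_combination -b * f4)
  have him : ∀ x, star x = -x → g x = 0 := by
    intro x hx
    have := hl x 1 hx
    rwa [h1, mul_one, mul_zero, neg_zero] at this
  have hp : p = (2 : K)⁻¹ • (p - star p) + p.fst.re • 1 := by
    have h3 : ∀ u : K, 2⁻¹ * u + 2⁻¹ * u = u := fun u => by field_simp; ring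
    ext <;> simp [mul_add, h3]
  rw [hp, map_add, map_smul, map_smul, h1, him _ (by rw [star_sub, star_star, neg_sub]), smul_zero,
    smul_zero, add_zero]

end Octonion

/-! ### The derivation on diagonal skew-Hermitian matrices. -/

section SkewHermitianDerivation

variable {K : Type*} [Field K] {a b c : K} {n : ℕ} {δ : K}
  {D : skewHermitianOctonionMatrix a b c n →ₗ[K] skewHermitianOctonionMatrix a b c n}

theorem map_skewDiag_commutator (h2 : (2 : K) ≠ 0)
    (hD : IsDeltaDerivation (skewHermitianOctonionMatrixMul a b c n) δ D) (i : Fin n)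
    {x y : Octonion a b c} (hx : star x = -x) (hy : star y = -y) :
    D (skewDiag i (x * y - y * x)) =
      δ • skewHermitianOctonionMatrixMul a b c n (skewDiag i x) (D (skewDiag i y)) -
        δ • skewHermitianOctonionMatrixMul a b c n (skewDiag i y) (D (skewDiag i x)) := by
  rw [← skewDiag_mul_skewDiag h2 i hx hy, hD, skewMul_swap (skewDiag i y), smul_neg]
  abel

theorem isImDelta_skewEntry (h2 : (2 : K) ≠ 0)
    (hD : IsDeltaDerivation (skewHermitianOctonionMatrixMul a b c n) δ D) (i : Fin n) :
    Octonion.IsImDelta δ (skewEntry i i ∘ₗ D ∘ₗ skewDiag i) where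
  star_map x _ := by
    have h := skewEntry_swap i i (D (skewDiag i x))
    simp only [LinearMap.comp_apply]
    rw [eq_neg_iff_add_eq_zero, add_comm, ← eq_neg_iff_add_eq_zero]
    exact h
  map_comm x y hx hy := by
    simp only [LinearMap.comp_apply]
    rw [map_skewDiag_commutator h2 hD i hx hy]
    simp only [map_sub, map_smul,
      skewEntry_skewDiag_mul h2 i i i hx, skewEntry_skewDiag_mul h2 i i i hy, if_true]
    rw [sub_eq_add_neg, ← smul_neg, neg_sub, add_comm]

/-- A product with `skewDiag i x` lives in row and column `i`, and commutators span the imaginary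
octonions. -/
theorem skewEntry_map_skewDiag_of_ne_of_ne (h2 : (2 : K) ≠ 0) (ha : a ≠ 0) (hb : b ≠ 0)
    (hD : IsDeltaDerivation (skewHermitianOctonionMatrixMul a b c n) δ D) {i k l : Fin n}
    (hk : k ≠ i) (hl : l ≠ i) {x : Octonion a b c} (hx : star x = -x) :
    skewEntry k l (D (skewDiag i x)) = 0 :=
  Octonion.map_eq_zero_of_map_commutator h2 ha hb (skewEntry k l ∘ₗ D ∘ₗ skewDiag i)
    (fun x y hx hy => by
      simp only [LinearMap.comp_apply]
      rw [map_skewDiag_commutator h2 hD i hx hy]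
      simp only [map_sub, map_smul,
        skewEntry_skewDiag_mul h2 i k l hx, skewEntry_skewDiag_mul h2 i k l hy, if_neg hk,
        if_neg hl, sub_zero, smul_zero]) hx

theorem skewEntry_map_skewDiag_of_ne (h2 : (2 : K) ≠ 0) (ha : a ≠ 0) (hb : b ≠ 0) (hδ : δ ≠ 1)
    (hD : IsDeltaDerivation (skewHermitianOctonionMatrixMul a b c n) δ D) {i j : Fin n}
    (hij : i ≠ j) {x : Octonion a b c} (hx : star x = -x) :
    skewEntry i j (D (skewDiag i x)) = 0 := by
  have hφ : ∀ x y : Octonion a b c, star x = -x → star y = -y →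
      (skewEntry i j ∘ₗ D ∘ₗ skewDiag i) (x * y - y * x) =
        δ • (x * (skewEntry i j ∘ₗ D ∘ₗ skewDiag i) y - y * (skewEntry i j ∘ₗ D ∘ₗ skewDiag i) x) := by
    intro x y hx hy
    simp only [LinearMap.comp_apply]
    rw [map_skewDiag_commutator h2 hD i hx hy]
    simp only [map_sub, map_smul,
      skewEntry_skewDiag_mul h2 i i j hx, skewEntry_skewDiag_mul h2 i i j hy, if_true,
      if_neg hij.symm, sub_zero, smul_sub]
  -- The products of different diagonal places vanish, but the resulting relation carries a factor
  -- `δ`, so `δ = 0` is treated apart.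
  by_cases h0 : δ = 0
  · exact Octonion.map_eq_zero_of_map_commutator h2 ha hb (skewEntry i j ∘ₗ D ∘ₗ skewDiag i)
      (fun x y hx hy => by rw [hφ x y hx hy, h0, zero_smul]) hx
  · refine Octonion.map_eq_zero_of_intertwining h2 ha hb hδ (skewEntry i j ∘ₗ D ∘ₗ skewDiag i)
      (skewEntry i j ∘ₗ D ∘ₗ skewDiag j) (fun x y hx hy => ?_) hφ hx
    have h1 := hD (skewDiag i x) (skewDiag j y)
    rw [skewDiag_mul_skewDiag_of_ne h2 hij hx hy, map_zero, ← smul_add] at h1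
    have h3 := congrArg (skewEntry i j) ((smul_eq_zero.1 h1.symm).resolve_left h0)
    rw [skewMul_swap (skewDiag j y), map_add, map_neg, map_zero,
      skewEntry_skewDiag_mul h2 i i j hx, skewEntry_skewDiag_mul h2 j i j hy] at h3
    simpa [hij, hij.symm] using h3

theorem exists_map_skewDiag (h2 : (2 : K) ≠ 0) (ha : a ≠ 0) (hb : b ≠ 0)
    (hc : c ≠ 0) (hδ : δ ≠ 1)
    (hD : IsDeltaDerivation (skewHermitianOctonionMatrixMul a b c n) δ D) (i : Fin n) :
    ∃ t : K, (2 * δ - 1) * t = 0 ∧ ∀ x, star x = -x → D (skewDiag i x) = t • skewDiag i x := by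
  obtain ⟨t, ht, h⟩ := (isImDelta_skewEntry h2 hD i).eq_smul h2 ha hb hc hδ
  refine ⟨t, ht, fun x hx => skew_ext fun k l => ?_⟩
  rw [map_smul, skewEntry_apply k l (skewDiag i x), coe_skewDiag h2 i hx]
  by_cases hk : k = i
  · subst hk
    by_cases hl : l = k
    · subst hl
      rw [Matrix.single_apply_same]
      exact h x hx
    · rw [skewEntry_map_skewDiag_of_ne h2 ha hb hδ hD (Ne.symm hl) hx,
        Matrix.single_apply_of_col_ne _ _ (Ne.symm hl), smul_zero]
  · rw [Matrix.single_apply_of_row_ne (Ne.symm hk), smul_zero]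
    by_cases hl : l = i
    · subst hl
      rw [skewEntry_swap l k, skewEntry_map_skewDiag_of_ne h2 ha hb hδ hD (Ne.symm hk) hx,
        star_zero, neg_zero]
    · exact skewEntry_map_skewDiag_of_ne_of_ne h2 ha hb hD hk hl hx

/-- By `ht`, `D - t • id` is again a `δ`-derivation, and it kills the diagonal place `i`. -/
theorem map_skewUnit_sub (h2 : (2 : K) ≠ 0)
    (hD : IsDeltaDerivation (skewHermitianOctonionMatrixMul a b c n) δ D) {i j : Fin n}
    (hij : i ≠ j) {t : K} (ht : (2 * δ - 1) * t = 0)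
    (h : ∀ x, star x = -x → D (skewDiag i x) = t • skewDiag i x)
    {x : Octonion a b c} (hx : star x = -x) (p : Octonion a b c) :
    D (skewUnit i j (x * p)) - t • skewUnit i j (x * p) =
      δ • skewHermitianOctonionMatrixMul a b c n (skewDiag i x)
        (D (skewUnit i j p) - t • skewUnit i j p) := by
  rw [map_sub, map_smul, ← skewDiag_mul_skewUnit h2 hij hx, hD, h x hx, map_smul,
    LinearMap.smul_apply]
  have h1 : (δ * t + δ * t - t) • skewHermitianOctonionMatrixMul a b c n (skewDiag i x)
      (skewUnit i j p) = 0 := by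
    rw [show δ * t + δ * t - t = 0 by linear_combination ht, zero_smul]
  rw [← sub_eq_zero, ← h1]
  module

theorem map_skewUnit_add (h2 : (2 : K) ≠ 0)
    (hD : IsDeltaDerivation (skewHermitianOctonionMatrixMul a b c n) δ D) {i j : Fin n}
    (hij : i ≠ j) {t : K} (ht : (2 * δ - 1) * t = 0)
    (h : ∀ x, star x = -x → D (skewDiag j x) = t • skewDiag j x)
    {x : Octonion a b c} (hx : star x = -x) (p : Octonion a b c) :
    D (skewUnit i j (p * x)) - t • skewUnit i j (p * x) =
      -(δ • skewHermitianOctonionMatrixMul a b c n (skewDiag j x)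
        (D (skewUnit i j p) - t • skewUnit i j p)) := by
  have hs := map_skewUnit_sub h2 hD hij.symm ht h hx (star p)
  rw [skewUnit_swap, show x * star p = -star (p * x) by rw [star_mul, hx, neg_mul, neg_neg],
    map_neg, skewUnit_swap] at hs
  rw [← sub_eq_zero] at hs ⊢
  rw [← hs]
  simp only [map_neg, map_sub, map_smul]
  module

end SkewHermitianDerivation

/-- Multiplying twice by `genI` gives `a u = δ² a u` for `u = g p - s p`, which settles `δ ^ 2 ≠ 1`.
For `δ = -1` one has `2δ - 1 = -3`, so characteristic different from `3` gives `s = t = 0` and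
`map_eq_zero_of_anti_module` applies. -/
theorem Octonion.eq_smul_of_bimodule_relation {K : Type*} [Field K] {a b c : K} (h2 : (2 : K) ≠ 0)
    (h3 : (3 : K) ≠ 0) (ha : a ≠ 0) (hb : b ≠ 0) {δ s t : K} (hδ : δ ≠ 1)
    (hs : (2 * δ - 1) * s = 0) (ht : (2 * δ - 1) * t = 0)
    (g : Octonion a b c →ₗ[K] Octonion a b c)
    (hl : ∀ x p, star x = -x → g (x * p) - s • (x * p) = δ • (x * (g p - s • p)))
    (hr : ∀ x p, star x = -x → g (p * x) - t • (p * x) = δ • ((g p - t • p) * x)) :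
    s = t ∧ ∀ p, g p = s • p := by
  by_cases h : δ ^ 2 = 1
  · obtain rfl : δ = -1 := (mul_self_eq_one_iff.1 (by rw [← sq, h])).resolve_left hδ
    have h0 : ∀ u : K, (2 * (-1) - 1) * u = 0 → u = 0 := by
      intro u hu
      have : 3 * u = 0 := by linear_combination -hu
      exact (mul_eq_zero.1 this).resolve_left h3
    obtain rfl := h0 s hs
    obtain rfl := h0 t ht
    refine ⟨rfl, fun p => ?_⟩
    rw [zero_smul]
    exact Octonion.map_eq_zero_of_anti_module h2 ha hb g
      (fun x p hx => by simpa using hl x p hx) (fun x p hx => by simpa using hr x p hx) p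
  · have cancel : ∀ u : Octonion a b c, a • u = δ • δ • a • u → u = 0 := by
      intro u hu
      have h1 : (a * (1 - δ ^ 2)) • u = 0 := by
        rw [← sub_eq_zero] at hu
        rw [← hu]
        module
      exact (smul_eq_zero.1 h1).resolve_left
        (mul_ne_zero ha fun h' => h (by linear_combination -h'))
    have e1 : ∀ p, g p = s • p := fun p => by
      refine sub_eq_zero.1 (cancel _ ?_)
      have h1 := hl genI (genI * p) star_genI
      rw [hl genI p star_genI, mul_smul_comm, mul_mul_self, mul_mul_self, genI_mul_self,
        smul_mul_assoc, smul_mul_assoc, one_mul, one_mul, map_smul] at h1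
      rw [← h1]
      module
    have e2 : ∀ p, g p = t • p := fun p => by
      refine sub_eq_zero.1 (cancel _ ?_)
      have h1 := hr genI (p * genI) star_genI
      rw [hr genI p star_genI, smul_mul_assoc, mul_self_mul, mul_self_mul, genI_mul_self,
        mul_smul_comm, mul_smul_comm, mul_one, mul_one, map_smul] at h1
      rw [← h1]
      module
    exact ⟨smul_left_injective K genI_ne_zero ((e1 genI).symm.trans (e2 genI)), e1⟩

/-! ### Off-diagonal skew-Hermitian matrices and the skew-Hermitian case. -/

section SkewHermitianDerivation

variable {K : Type*} [Field K] {a b c : K} {n : ℕ} {δ : K}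
  {D : skewHermitianOctonionMatrix a b c n →ₗ[K] skewHermitianOctonionMatrix a b c n}

theorem skewEntry_skewUnit (i j k l : Fin n) (p : Octonion a b c) :
    skewEntry k l (skewUnit i j p) =
      (if i = k ∧ j = l then p else 0) - (if j = k ∧ i = l then star p else 0) := rfl

/-- Since `genI * (genI * p) = a p`, the image is, up to multiples of `skewUnit i j p`, a product
with `skewDiag i genI`, hence supported in row and column `i`. -/
theorem skewEntry_map_skewUnit_eq_zero_left (h2 : (2 : K) ≠ 0) (ha : a ≠ 0)
    (hD : IsDeltaDerivation (skewHermitianOctonionMatrixMul a b c n) δ D) {i j : Fin n}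
    (hij : i ≠ j) {t : K} (ht : (2 * δ - 1) * t = 0)
    (h : ∀ x, star x = -x → D (skewDiag i x) = t • skewDiag i x) {k l : Fin n} (hk : k ≠ i)
    (hl : l ≠ i) (p : Octonion a b c) : skewEntry k l (D (skewUnit i j p)) = 0 := by
  have h1 := congrArg (skewEntry k l)
    (map_skewUnit_sub h2 hD hij ht h Octonion.star_genI (Octonion.genI * p))
  rw [map_smul, skewEntry_skewDiag_mul h2 i k l Octonion.star_genI, if_neg hk, if_neg hl, sub_zero,
    smul_zero, map_sub, map_smul, skewEntry_skewUnit, if_neg (fun h => hk h.1.symm),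
    if_neg (fun h => hl h.2.symm), sub_zero, smul_zero, sub_zero, Octonion.mul_mul_self,
    Octonion.genI_mul_self, smul_mul_assoc, one_mul, map_smul, map_smul, map_smul] at h1
  exact (smul_eq_zero.1 h1).resolve_left ha

theorem skewEntry_map_skewUnit_eq_zero_right (h2 : (2 : K) ≠ 0) (ha : a ≠ 0)
    (hD : IsDeltaDerivation (skewHermitianOctonionMatrixMul a b c n) δ D) {i j : Fin n}
    (hij : i ≠ j) {t : K} (ht : (2 * δ - 1) * t = 0)
    (h : ∀ x, star x = -x → D (skewDiag j x) = t • skewDiag j x) {k l : Fin n} (hk : k ≠ j)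
    (hl : l ≠ j) (p : Octonion a b c) : skewEntry k l (D (skewUnit i j p)) = 0 := by
  rw [← star_star p, skewUnit_swap, map_neg, map_neg, neg_eq_zero]
  exact skewEntry_map_skewUnit_eq_zero_left h2 ha hD hij.symm ht h hk hl _

theorem map_skewUnit_of_ne (h2 : (2 : K) ≠ 0) (h3 : (3 : K) ≠ 0) (ha : a ≠ 0) (hb : b ≠ 0)
    (hδ : δ ≠ 1) (hD : IsDeltaDerivation (skewHermitianOctonionMatrixMul a b c n) δ D)
    {i j : Fin n} (hij : i ≠ j) {s t : K} (hs : (2 * δ - 1) * s = 0) (ht : (2 * δ - 1) * t = 0)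
    (h : ∀ x, star x = -x → D (skewDiag i x) = s • skewDiag i x)
    (h' : ∀ x, star x = -x → D (skewDiag j x) = t • skewDiag j x) :
    s = t ∧ ∀ p, D (skewUnit i j p) = s • skewUnit i j p := by
  have hE : ∀ p : Octonion a b c, skewEntry i j (skewUnit i j p) = p := fun p => by
    simp [skewEntry_skewUnit, hij]
  obtain ⟨hst, hg⟩ := Octonion.eq_smul_of_bimodule_relation h2 h3 ha hb hδ hs ht
    (skewEntry i j ∘ₗ D ∘ₗ skewUnit i j)
    (fun x p hx => by
      have h1 := congrArg (skewEntry i j) (map_skewUnit_sub h2 hD hij hs h hx p)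
      rw [map_smul, skewEntry_skewDiag_mul h2 i i j hx, if_pos rfl, if_neg hij.symm, sub_zero,
        map_sub, map_sub, map_smul, map_smul, hE, hE] at h1
      exact h1)
    (fun x p hx => by
      have h1 := congrArg (skewEntry i j) (map_skewUnit_add h2 hD hij ht h' hx p)
      rw [map_neg, map_smul, skewEntry_skewDiag_mul h2 j i j hx, if_neg hij, if_pos rfl, zero_sub,
        smul_neg, neg_neg, map_sub, map_sub, map_smul, map_smul, hE, hE] at h1
      exact h1)
  refine ⟨hst, fun p => skew_ext fun k l => ?_⟩
  have hg' : skewEntry i j (D (skewUnit i j p)) = s • p := hg p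
  rw [map_smul]
  by_cases hki : k = i ∧ l = j
  · obtain ⟨rfl, rfl⟩ := hki
    rw [hg', hE]
  by_cases hkj : k = j ∧ l = i
  · obtain ⟨rfl, rfl⟩ := hkj
    rw [skewEntry_swap l k, skewEntry_swap l k (skewUnit l k p), hg', hE, Octonion.star_smul',
      smul_neg]
  have h0 : skewEntry k l (skewUnit i j p) = 0 := by
    rw [skewEntry_skewUnit, if_neg (fun h => hki ⟨h.1.symm, h.2.symm⟩),
      if_neg (fun h => hkj ⟨h.1.symm, h.2.symm⟩), sub_zero]
  rw [h0, smul_zero]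
  -- Every place other than `(i, j)` and `(j, i)` avoids the index `i` or the index `j`.
  by_cases hi : k ≠ i ∧ l ≠ i
  · exact skewEntry_map_skewUnit_eq_zero_left h2 ha hD hij hs h hi.1 hi.2 p
  · refine skewEntry_map_skewUnit_eq_zero_right h2 ha hD hij ht h' ?_ ?_ p
    · rintro rfl
      have : l = i := by
        by_contra hl
        exact hi ⟨hij.symm, hl⟩
      exact hkj ⟨rfl, this⟩
    · rintro rfl
      have : k = i := by
        by_contra hk
        exact hi ⟨hk, hij.symm⟩
      exact hki ⟨this, rfl⟩

theorem skewHermitian_deltaDerivation (h2 : (2 : K) ≠ 0) (h3 : (3 : K) ≠ 0) (ha : a ≠ 0)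
    (hb : b ≠ 0) (hc : c ≠ 0) (hD0 : D ≠ 0)
    (hD : IsDeltaDerivation (skewHermitianOctonionMatrixMul a b c n) δ D) :
    δ = 1 ∨ (δ = 1 / 2 ∧ ∃ t : K, D = t • LinearMap.id) := by
  refine or_iff_not_imp_left.2 fun hδ => ?_
  choose t ht h using exists_map_skewDiag h2 ha hb hc hδ hD
  have hE : ∀ i j p, D (skewUnit i j p) = t i • skewUnit i j p := by
    intro i j p
    by_cases hij : i = j
    · subst hij
      have hp : star (p - star p) = -(p - star p) := by rw [star_sub, star_star, neg_sub]
      have h1 : skewUnit i i p = (skewDiag i (p - star p) : skewHermitianOctonionMatrix a b c n) := by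
        rw [skewDiag, LinearMap.smul_apply, map_sub, skewUnit_swap, sub_neg_eq_add,
          ← two_smul K (skewUnit i i p), inv_smul_smul₀ h2]
      rw [h1, h i _ hp]
    · exact (map_skewUnit_of_ne h2 h3 ha hb hδ hD hij (ht i) (ht j) (h i) (h j)).2 p
  obtain ⟨s, hs, hts⟩ : ∃ s : K, (2 * δ - 1) * s = 0 ∧ ∀ i, t i = s := by
    rcases isEmpty_or_nonempty (Fin n) with hn | ⟨⟨i⟩⟩
    · exact ⟨0, mul_zero _, fun i => hn.elim i⟩
    · refine ⟨t i, ht i, fun j => ?_⟩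
      by_cases hij : j = i
      · rw [hij]
      · exact (map_skewUnit_of_ne h2 h3 ha hb hδ hD hij (ht j) (ht i) (h j) (h i)).1
  have hDs : D = s • LinearMap.id := by
    ext1 X
    conv_lhs => rw [eq_sum_skewUnit h2 X]
    conv_rhs => rw [LinearMap.smul_apply, LinearMap.id_apply, eq_sum_skewUnit h2 X]
    simp only [map_smul, map_sum, hE, hts, ← Finset.smul_sum]
    rw [smul_comm]
  refine ⟨?_, s, hDs⟩
  have hs0 : s ≠ 0 := by
    rintro rfl
    exact hD0 (by rw [hDs, zero_smul])
  rw [eq_div_iff h2]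
  linear_combination (mul_eq_zero.1 hs).resolve_right hs0

end SkewHermitianDerivation

/-! ### The Hermitian case. -/

section Hermitian

variable {K : Type*} [Field K] {a b c : K} {n : ℕ} {δ : K}
  {D : hermitianOctonionMatrix a b c n →ₗ[K] hermitianOctonionMatrix a b c n}

/-- The Hermitian matrix with entry `1` in the places `(i, j)` and `(j, i)`
(these are added if `i = j`). -/
def hermUnit (i j : Fin n) : hermitianOctonionMatrix a b c n :=
  ⟨Matrix.single i j 1 + Matrix.single j i 1, by
    change (_ : Matrix _ _ _)ᴴ = _
    rw [Matrix.conjTranspose_add, Matrix.conjTranspose_single, Matrix.conjTranspose_single,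
      star_one, add_comm]⟩

/-- The Hermitian matrix unit on the diagonal. -/
def hermDiag (i : Fin n) : hermitianOctonionMatrix a b c n :=
  ⟨Matrix.single i i 1, by
    change (_ : Matrix _ _ _)ᴴ = _
    rw [Matrix.conjTranspose_single, star_one]⟩

theorem coe_hermUnit (i j : Fin n) : (hermUnit i j : hermitianOctonionMatrix a b c n).1 =
    Matrix.single i j 1 + Matrix.single j i 1 := rfl

theorem coe_hermDiag (i : Fin n) :
    (hermDiag i : hermitianOctonionMatrix a b c n).1 = Matrix.single i i 1 := rfl

/-- The identity matrix. -/
def hermOne : hermitianOctonionMatrix a b c n := ⟨1, Matrix.conjTranspose_one⟩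

theorem coe_hermMul (X Y : hermitianOctonionMatrix a b c n) :
    (hermitianOctonionMatrixMul a b c n X Y).1 = (2 : K)⁻¹ • (X.1 * Y.1 + Y.1 * X.1) := rfl

theorem hermMul_comm (X Y : hermitianOctonionMatrix a b c n) :
    hermitianOctonionMatrixMul a b c n X Y = hermitianOctonionMatrixMul a b c n Y X :=
  Subtype.ext (by rw [coe_hermMul, coe_hermMul, add_comm])

theorem hermOne_mul (h2 : (2 : K) ≠ 0) (X : hermitianOctonionMatrix a b c n) :
    hermitianOctonionMatrixMul a b c n hermOne X = X :=
  Subtype.ext (by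
    rw [coe_hermMul, hermOne, one_mul, mul_one, ← two_smul K, inv_smul_smul₀ h2])

theorem map_eq_hermMul (h2 : (2 : K) ≠ 0)
    (hD : IsDeltaDerivation (hermitianOctonionMatrixMul a b c n) δ D)
    (X : hermitianOctonionMatrix a b c n) :
    D X = δ • hermitianOctonionMatrixMul a b c n (D hermOne) X + δ • D X := by
  have h := hD hermOne X
  rwa [hermOne_mul h2, hermOne_mul h2] at h

theorem eq_one_of_ne_half (h2 : (2 : K) ≠ 0) (hD0 : D ≠ 0) (hδ : δ ≠ 1 / 2)
    (hD : IsDeltaDerivation (hermitianOctonionMatrixMul a b c n) δ D) : δ = 1 := by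
  have h1 := map_eq_hermMul h2 hD hermOne
  rw [hermMul_comm, hermOne_mul h2] at h1
  have h3 : (2 * δ - 1) • D hermOne = 0 := by
    rw [← sub_eq_zero.2 h1.symm]
    module
  have h4 : D hermOne = 0 := (smul_eq_zero.1 h3).resolve_left fun h =>
    hδ (by rw [eq_div_iff h2]; linear_combination h)
  by_contra hne
  apply hD0
  ext1 X
  have h5 := map_eq_hermMul h2 hD X
  rw [h4, map_zero, LinearMap.zero_apply, smul_zero, zero_add] at h5
  have h6 : (1 - δ) • D X = 0 := by
    rw [← sub_eq_zero.2 h5]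
    module
  exact (smul_eq_zero.1 h6).resolve_left (sub_ne_zero.2 (Ne.symm hne))

theorem map_eq_hermMul_of_half (h2 : (2 : K) ≠ 0)
    (hD : IsDeltaDerivation (hermitianOctonionMatrixMul a b c n) (1 / 2) D)
    (X : hermitianOctonionMatrix a b c n) :
    D X = hermitianOctonionMatrixMul a b c n (D hermOne) X := by
  have h1 := congrArg ((2 : K) • ·) (map_eq_hermMul h2 hD X)
  simp only [smul_add, smul_smul, mul_one_div_cancel h2, one_smul, two_smul] at h1
  exact add_right_cancel h1

/-- Put `z = D 1` and let `e` be the diagonal idempotent at `i`. Applying `D` to `e ∘ e = e` gives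
`e ∘ z = e ∘ (e ∘ z)`, whose `(i, j)` entries are `z i j / 2` and `z i j / 4`. -/
theorem coe_map_hermOne_of_ne (h2 : (2 : K) ≠ 0)
    (hD : IsDeltaDerivation (hermitianOctonionMatrixMul a b c n) (1 / 2) D) {i j : Fin n}
    (hij : i ≠ j) : (D hermOne).1 i j = 0 := by
  have he : hermitianOctonionMatrixMul a b c n (hermDiag i) (hermDiag i) = hermDiag i :=
    Subtype.ext (by
      rw [coe_hermMul, coe_hermDiag, Matrix.single_mul_single_same, one_mul, ← two_smul K,
        inv_smul_smul₀ h2])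
  have hent : ∀ Y : hermitianOctonionMatrix a b c n,
      (hermitianOctonionMatrixMul a b c n (hermDiag i) Y).1 i j = (2 : K)⁻¹ • Y.1 i j := by
    intro Y
    rw [coe_hermMul, Matrix.smul_apply, Matrix.add_apply, coe_hermDiag, Matrix.single_mul_apply_same,
      Matrix.mul_single_apply_of_ne _ _ _ _ _ hij.symm, one_mul, add_zero]
  have h1 := hD (hermDiag i) (hermDiag i)
  rw [he, hermMul_comm (D _), ← two_smul K, smul_smul, mul_one_div_cancel h2, one_smul] at h1
  have h3 := congrFun (congrFun (congrArg Subtype.val h1) i) j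
  rw [hent, map_eq_hermMul_of_half h2 hD, hermMul_comm, hent] at h3
  have h4 : ((2 : K)⁻¹ * 2⁻¹) • (D hermOne).1 i j = 0 := by
    have h5 : ((2 : K)⁻¹ - 2⁻¹ * 2⁻¹) • (D hermOne).1 i j = 0 := by
      rw [sub_smul, mul_smul, ← h3, sub_self]
    convert h5 using 2
    field_simp
    ring
  exact (smul_eq_zero.1 h4).resolve_left (mul_ne_zero (inv_ne_zero h2) (inv_ne_zero h2))

theorem Octonion.eq_smul_one_of_star_eq (h2 : (2 : K) ≠ 0) {x : Octonion a b c} (hx : star x = x) :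
    x = x.fst.re • 1 := by
  have h0 : ∀ u : K, -u = u → u = 0 := fun u hu =>
    (mul_eq_zero.1 (by linear_combination -hu : 2 * u = 0)).resolve_left h2
  rw [Octonion.ext_iff, QuaternionAlgebra.ext_iff, QuaternionAlgebra.ext_iff] at hx
  simp at hx
  obtain ⟨⟨e1, e2, e3⟩, e4, e5, e6, e7⟩ := hx
  ext <;> simp [h0 _ e1, h0 _ e2, h0 _ e3, h0 _ e4, h0 _ e5, h0 _ e6, h0 _ e7]

theorem coe_map_apply_of_half (h2 : (2 : K) ≠ 0)
    (hD : IsDeltaDerivation (hermitianOctonionMatrixMul a b c n) (1 / 2) D)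
    (X : hermitianOctonionMatrix a b c n) (k l : Fin n) :
    (D X).1 k l =
      ((2 : K)⁻¹ * (((D hermOne).1 k k).fst.re + ((D hermOne).1 l l).fst.re)) • X.1 k l := by
  have hz : (D hermOne).1 =
      Matrix.diagonal fun i => (((D hermOne).1 i i).fst.re • 1 : Octonion a b c) := by
    ext1 i j
    by_cases hij : i = j
    · subst hij
      have h : (D hermOne).1ᴴ = (D hermOne).1 := (D hermOne).2
      rw [Matrix.diagonal_apply_eq]
      exact Octonion.eq_smul_one_of_star_eq h2 (congrFun (congrFun h i) i)
    · rw [Matrix.diagonal_apply_ne _ hij, coe_map_hermOne_of_ne h2 hD hij]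
  rw [map_eq_hermMul_of_half h2 hD, coe_hermMul, Matrix.smul_apply, Matrix.add_apply]
  conv_lhs => rw [hz]
  rw [Matrix.diagonal_mul, Matrix.mul_diagonal, smul_mul_assoc, one_mul, mul_smul_comm, mul_one,
    ← add_smul, smul_smul]

/-- With `s`, `t` the two scalars, `D` acts on the unit `u` at `(i, j)` by `(s + t) / 2` and on the
idempotent at `i` by `s`. The derivation rule on their product `u / 2` reads `(s + t) / 4 = s / 4 +
(s + t) / 8`. -/
theorem re_map_hermOne_eq (h2 : (2 : K) ≠ 0)
    (hD : IsDeltaDerivation (hermitianOctonionMatrixMul a b c n) (1 / 2) D) (i j : Fin n) :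
    ((D hermOne).1 i i).fst.re = ((D hermOne).1 j j).fst.re := by
  by_cases hij : i = j
  · rw [hij]
  generalize hs : ((D hermOne).1 i i).fst.re = s
  generalize ht : ((D hermOne).1 j j).fst.re = t
  have hcoe := coe_map_apply_of_half h2 hD
  have hu : hermitianOctonionMatrixMul a b c n (hermDiag i) (hermUnit i j) =
      (2 : K)⁻¹ • hermUnit i j := by
    apply Subtype.ext
    rw [coe_hermMul, Submodule.coe_smul, coe_hermDiag, coe_hermUnit, mul_add, add_mul,
      Matrix.single_mul_single_same, Matrix.single_mul_single_same,
      Matrix.single_mul_single_of_ne _ _ _ _ hij,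
      Matrix.single_mul_single_of_ne _ _ _ _ (Ne.symm hij), one_mul, add_zero, zero_add]
  have hDe : D (hermDiag i) = s • hermDiag i := by
    apply Subtype.ext
    ext1 k l
    rw [hcoe, Submodule.coe_smul, Matrix.smul_apply, coe_hermDiag]
    by_cases h : i = k ∧ i = l
    · obtain ⟨rfl, rfl⟩ := h
      rw [hs, ← two_mul, inv_mul_cancel_left₀ h2]
    · rw [Matrix.single_apply_of_ne _ _ _ _ _ h, smul_zero, smul_zero]
  have hDu : D (hermUnit i j) = ((2 : K)⁻¹ * (s + t)) • hermUnit i j := by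
    apply Subtype.ext
    ext1 k l
    rw [hcoe, Submodule.coe_smul, Matrix.smul_apply, coe_hermUnit]
    by_cases h : i = k ∧ j = l
    · obtain ⟨rfl, rfl⟩ := h
      rw [hs, ht]
    by_cases h' : j = k ∧ i = l
    · obtain ⟨rfl, rfl⟩ := h'
      rw [hs, ht, add_comm t s]
    · rw [Matrix.add_apply, Matrix.single_apply_of_ne _ _ _ _ _ h,
        Matrix.single_apply_of_ne _ _ _ _ _ h', add_zero, smul_zero, smul_zero]
  have h1 := hD (hermDiag i) (hermUnit i j)
  rw [hDe, hDu, map_smul, map_smul, LinearMap.smul_apply, hu, map_smul, hDu] at h1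
  have hu1 : (hermUnit i j : hermitianOctonionMatrix a b c n).1 i j = 1 := by
    rw [coe_hermUnit, Matrix.add_apply, Matrix.single_apply_same,
      Matrix.single_apply_of_ne _ _ _ _ _ (fun h => hij h.1.symm), add_zero]
  have h3 := congrArg (fun Y : hermitianOctonionMatrix a b c n => (Y.1 i j).fst.re) h1
  simp only [Submodule.coe_add, Submodule.coe_smul, Matrix.add_apply, Matrix.smul_apply, hu1,
    Octonion.fst_add, Octonion.fst_smul, Octonion.fst_one, QuaternionAlgebra.re_add,
    QuaternionAlgebra.re_smul, QuaternionAlgebra.re_one, smul_eq_mul, mul_one] at h3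
  field_simp at h3
  linear_combination -h3

theorem hermitian_deltaDerivation (h2 : (2 : K) ≠ 0) (hD0 : D ≠ 0)
    (hD : IsDeltaDerivation (hermitianOctonionMatrixMul a b c n) δ D) :
    δ = 1 ∨ (δ = 1 / 2 ∧ ∃ t : K, D = t • LinearMap.id) := by
  by_cases hδ : δ = 1 / 2
  · subst hδ
    refine Or.inr ⟨rfl, ?_⟩
    obtain ⟨t, ht⟩ : ∃ t : K, ∀ i, ((D hermOne).1 i i).fst.re = t := by
      rcases isEmpty_or_nonempty (Fin n) with hn | ⟨⟨i⟩⟩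
      · exact ⟨0, fun i => hn.elim i⟩
      · exact ⟨_, fun j => re_map_hermOne_eq h2 hD j i⟩
    refine ⟨t, LinearMap.ext fun X => Subtype.ext (Matrix.ext fun k l => ?_)⟩
    rw [coe_map_apply_of_half h2 hD, ht, ht, ← two_mul, inv_mul_cancel_left₀ h2]
    rfl
  · exact Or.inl (eq_one_of_ne_half h2 hD0 hδ hD)

end Hermitian

theorem theorem2 {K : Type*} [Field K] (h2 : (2 : K) ≠ 0) (h3 : (3 : K) ≠ 0)
    (a b c : K) (ha : a ≠ 0) (hb : b ≠ 0) (hc : c ≠ 0) (n : ℕ) (δ : K) :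
    (∀ D : hermitianOctonionMatrix a b c n →ₗ[K] hermitianOctonionMatrix a b c n,
      D ≠ 0 → IsDeltaDerivation (hermitianOctonionMatrixMul a b c n) δ D →
        δ = 1 ∨ (δ = 1 / 2 ∧ ∃ t : K, D = t • LinearMap.id)) ∧
    (∀ D : skewHermitianOctonionMatrix a b c n →ₗ[K] skewHermitianOctonionMatrix a b c n,
      D ≠ 0 → IsDeltaDerivation (skewHermitianOctonionMatrixMul a b c n) δ D →
        δ = 1 ∨ (δ = 1 / 2 ∧ ∃ t : K, D = t • LinearMap.id)) :=
  ⟨fun _ hD0 hD => hermitian_deltaDerivation h2 hD0 hD,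
    fun _ hD0 hD => skewHermitian_deltaDerivation h2 h3 ha hb hc hD0 hD⟩
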